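/- Let $b\neq 0$, $27s-38b^2>0$, $\varepsilon>0$, $\omega\in(-\tfrac12,\tfrac12)$ with $1+2\varepsilon\omega>0$, and let $\tilde u=\tilde u(x)$ be a roll, i.e. a real, even, $2\pi$-periodic stationary solution of $$\partial_t u=-(1+(1+2\varepsilon\omega)\partial_x^2+\partial_y^2)^2u+\varepsilon^2u+bu^2-su^3 .$$ Let $$\mathcal L=-(1+(1+2\varepsilon\omega)\partial_x^2+\partial_y^2)^2+\varepsilon^2+2b\tilde u-3s\tilde u^2$$ be the linearization about $\tilde u$ on $L^2(\mathbb R^2)$ with domain $H^4(\mathbb R^2)$, and for $\sigma=(\sigma_1,\sigma_2)\in\mathbb R^2$ let $$B(\sigma)=-\big[1+(1+2\varepsilon\omega)(\partial_x+i\sigma_1)^2-\sigma_2^2\big]^2+\varepsilon^2+2b\tilde u-3s\tilde u^2$$ be the Bloch operators on $L^2(\mathbb T)$, $\mathbb T=\mathbb R/2\pi\mathbb Z$, with domain $H^4(\mathbb T)$. Let $\bar\sigma\in\mathbb R^2$, $0<c_0\le 1$ and $I\times J=[\bar\sigma_1,\bar\sigma_1+c_0]\times[\bar\sigma_2,\bar\sigma_2+c_0]$.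 Suppose that for every $\sigma\in I\times J$ the number $\lambda(\sigma)>0$ is an (unstable) eigenvalue of $B(\sigma)$ with eigenfunction $W(\cdot,\sigma)\neq 0$, that $\sigma\mapsto W(\cdot,\sigma)\in H^2(\mathbb T)$ is continuous on $I\times J$, and that $\lambda_M:=\lambda(\bar\sigma)$ is the largest growth rate: no $B(\sigma)$, $\sigma\in\mathbb R^2$, has an eigenvalue larger than $\lambda_M$. Put $$U(x,y)=\int_{I\times J}e^{i(\sigma_1x+\sigma_2y)}W(x,\sigma)\,d\sigma,\qquad e(t)=\Big(\int_{I\times J}e^{2(\lambda(\sigma)-\lambda_M)t}\,d\sigma\Big)^{1/2}.$$ Then $U\in L^2(\mathbb R^2)$; the linearized equation $V_t=\mathcal LV$, $V(0)=U$ has exactly one solution $V=e^{t\mathcal L}U$ on $[0,\infty)$ (continuous on $[0,\infty)$ with values in $L^2(\mathbb R^2)$ and, for $t>0$, differentiable in $L^2(\mathbb R^2)$ with values in $H^4(\mathbb R^2)$); $e^{t\mathcal L}U\in H^2(\mathbb R^2)$ for all $t\ge 0$; and there is a constant $C\ge1$ with $$C^{-1}e^{\lambda_Mt}e(t)\le\|e^{t\mathcal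 L}U\|_{H^2(\mathbb R^2)}\le C\,e^{\lambda_Mt}e(t)\qquad\text{for all }t\ge0 .$$ Moreover there are positive constants $l$, $C_1$, $C_2$ with $$\frac{C_1}{(1+t)^{1/l}}\le e(t)\le C_2\qquad\text{for all }t\ge0 ,$$ and the lower bound holds (with some $C_1>0$ depending on $l$) for every integer $l\ge1$ such that $\lambda(\sigma)-\lambda_M=O(|\sigma-\bar\sigma|^l)$ as $\sigma\to\bar\sigma$ in $I\times J$; in particular, if $\lambda$ is analytic near $\bar\sigma$ and not constant, for the order $l$ of the first non-vanishing term in its Taylor expansion at $\bar\sigma$ after the constant one. -/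

import Mathlib

open MeasureTheory TemperedDistribution FourierTransform Filter Topology
open scoped LineDeriv SchwartzMap ENNReal

noncomputable section

namespace RollInstability

/-- The plane `ℝ²` of the variables `(x, y) = (p 0, p 1)`. -/
abbrev Plane : Type := EuclideanSpace ℝ (Fin 2)

/-- Complex `L²(ℝ²)`. -/
abbrev L2Plane : Type := Lp ℂ 2 (volume : Measure Plane)

/-- `(1 + (1 + 2εω)∂ₓ²) f`. -/
def rollOp (ε ω : ℝ) (f : ℝ → ℝ) (x : ℝ) : ℝ :=
  f x + (1 + 2 * ε * ω) * deriv (deriv f) x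

/-- `u` is a roll profile of the generalized Swift–Hohenberg equation
`∂ₜu = -(1 + (1 + 2εω)∂ₓ² + ∂_y²)²u + ε²u + bu² - su³`: an even, `2π`-periodic stationary
solution that depends on `x` only. -/
def IsRoll (ε ω b s : ℝ) (u : ℝ → ℝ) : Prop :=
  ContDiff ℝ 4 u ∧ Function.Periodic u (2 * Real.pi) ∧ Function.Even u ∧
    ∀ x, -(rollOp ε ω (rollOp ε ω u) x) + ε ^ 2 * u x + b * u x ^ 2 - s * u x ^ 3 = 0

/-- The zeroth-order coefficient `ε² + 2bu - 3su²` of the linearization about `u`. -/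
def potential (ε b s : ℝ) (u : ℝ → ℝ) (x : ℝ) : ℝ :=
  ε ^ 2 + 2 * b * u x - 3 * s * u x ^ 2

/-! ### The linearized operator on `L²(ℝ²)` -/

/-- `1 + (1 + 2εω)∂ₓ² + ∂_y²` on tempered distributions. -/
def planeOp (ε ω : ℝ) (v : 𝓢'(Plane, ℂ)) : 𝓢'(Plane, ℂ) :=
  v + ((1 + 2 * ε * ω : ℝ) : ℂ) •
      ∂_{(EuclideanSpace.single 0 1 : Plane)} (∂_{(EuclideanSpace.single 0 1 : Plane)} v) +
    ∂_{(EuclideanSpace.single 1 1 : Plane)} (∂_{(EuclideanSpace.single 1 1 : Plane)} v)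

/-- The graph of the operator `𝓛 = -(1 + (1 + 2εω)∂ₓ² + ∂_y²)² + ε² + 2bu - 3su²` on `L²(ℝ²)` with
domain `H⁴(ℝ²)`: `v ∈ H⁴(ℝ²)` and `𝓛 v = f`. Here `g` is the product of `v` with the potential. -/
def LinearizedOp (ε ω b s : ℝ) (u : ℝ → ℝ) (v f : L2Plane) : Prop :=
  MemSobolev 4 2 (v : 𝓢'(Plane, ℂ)) ∧
    ∃ g : L2Plane, (∀ᵐ p : Plane, g p = (potential ε b s u (p 0) : ℂ) * v p) ∧
      (f : 𝓢'(Plane, ℂ)) = -planeOp ε ω (planeOp ε ω (v : 𝓢'(Plane, ℂ))) + (g : 𝓢'(Plane, ℂ))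

/-- `V` is the orbit `t ↦ e^{t𝓛} w`, `t ≥ 0`, where `𝓛` is given by its graph: `V` is continuous on
`[0, ∞)` with values in `L²(ℝ²)`, `V 0 = w`, and for `t > 0` the value `V t` lies in the domain of
`𝓛` and `V' t = 𝓛 (V t)`. -/
def IsSemigroupOrbit (L : L2Plane → L2Plane → Prop) (w : L2Plane) (V : ℝ → L2Plane) : Prop :=
  V 0 = w ∧ ContinuousOn V (Set.Ici 0) ∧ ∀ t, 0 < t → ∃ f, L (V t) f ∧ HasDerivAt V f t

/-- The norm `‖v‖_{H^p(ℝ²)} = (∫ (1 + |ξ|²)^p |v̂(ξ)|² dξ)^{1/2}`. Mathlib's Fourier transform uses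
the kernel `e^{-2πi⟨ξ, ·⟩}`, hence the factor `2π`. -/
def sobolevNorm (p : ℕ) (v : L2Plane) : ℝ :=
  (eLpNorm (fun ξ : Plane =>
    (((1 + (2 * Real.pi * ‖ξ‖) ^ 2) ^ ((p : ℝ) / 2) : ℝ) : ℂ) * (𝓕 v : L2Plane) ξ) 2 volume).toReal

/-! ### Bloch operators on `L²(𝕋)`, `𝕋 = ℝ / 2πℤ` -/

/-- `(∂ₓ + iσ₁) f`. -/
def blochDeriv (σ : ℝ × ℝ) (f : ℝ → ℂ) (x : ℝ) : ℂ :=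
  deriv f x + Complex.I * σ.1 * f x

/-- `(1 + (1 + 2εω)(∂ₓ + iσ₁)² - σ₂²) f`. -/
def blochInner (ε ω : ℝ) (σ : ℝ × ℝ) (f : ℝ → ℂ) (x : ℝ) : ℂ :=
  f x + ((1 + 2 * ε * ω : ℝ) : ℂ) * blochDeriv σ (blochDeriv σ f) x - (σ.2 : ℂ) ^ 2 * f x

/-- The Bloch operator
`B(σ) = -(1 + (1 + 2εω)(∂ₓ + iσ₁)² - σ₂²)² + ε² + 2bu - 3su²` applied to `w`. -/
def blochOp (ε ω b s : ℝ) (u : ℝ → ℝ) (σ : ℝ × ℝ) (w : ℝ → ℂ) (x : ℝ) : ℂ :=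
  -(blochInner ε ω σ (blochInner ε ω σ w) x) + (potential ε b s u x : ℂ) * w x

/-- `w` is an eigenfunction of `B(σ)` for the eigenvalue `μ`. As the coefficients of `B(σ)` are
continuous for a roll `u`, every eigenfunction in the domain `H⁴(𝕋)` is of class `C⁴`, so these are
all eigenfunctions of `B(σ)` on `L²(𝕋)`. -/
def IsBlochEigenfunction (ε ω b s : ℝ) (u : ℝ → ℝ) (σ : ℝ × ℝ) (μ : ℝ) (w : ℝ → ℂ) : Prop :=
  ContDiff ℝ 4 w ∧ Function.Periodic w (2 * Real.pi) ∧ w ≠ 0 ∧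
    ∀ x, blochOp ε ω b s u σ w x = μ * w x

/-- `ĥ(j) = (1 / 2π) ∫₀^{2π} e^{-ijx} h(x) dx`. -/
def torusCoeff (h : ℝ → ℂ) (j : ℤ) : ℂ :=
  (1 / (2 * Real.pi : ℝ) : ℂ) *
    ∫ x in (0 : ℝ)..(2 * Real.pi), Complex.exp (-(Complex.I * j * x)) * h x

/-- `‖h‖²_{H^p(𝕋)} = ∑ⱼ (1 + j²)^p |ĥ(j)|²`, possibly infinite. -/
def torusSobolevSq (p : ℕ) (h : ℝ → ℂ) : ℝ≥0∞ :=
  ∑' j : ℤ, ENNReal.ofReal ((1 + (j : ℝ) ^ 2) ^ p * ‖torusCoeff h j‖ ^ 2)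

/-- `σ ↦ W(·, σ)` is continuous from `K` to `H^p(𝕋)`. -/
def ContinuousFamilyOn (p : ℕ) (W : ℝ × ℝ → ℝ → ℂ) (K : Set (ℝ × ℝ)) : Prop :=
  ∀ σ₀ ∈ K, Tendsto (fun σ => torusSobolevSq p (fun x => W σ x - W σ₀ x)) (𝓝[K] σ₀) (𝓝 0)

/-! ### The superposition and the prefactor -/

/-- The square `I × J = [σ̄₁, σ̄₁ + c] × [σ̄₂, σ̄₂ + c]`. -/
def square (σbar : ℝ × ℝ) (c : ℝ) : Set (ℝ × ℝ) :=
  Set.Icc σbar.1 (σbar.1 + c) ×ˢ Set.Icc σbar.2 (σbar.2 + c)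

/-- `U(x, y) = ∫_K e^{i(σ₁x + σ₂y)} W(x, σ) dσ`. -/
def blochSuperposition (K : Set (ℝ × ℝ)) (W : ℝ × ℝ → ℝ → ℂ) (p : Plane) : ℂ :=
  ∫ σ in K, Complex.exp (Complex.I * (σ.1 * p 0 + σ.2 * p 1)) * W σ (p 0)

/-- `e(t) = (∫_{I × J} e^{2(λ(σ) - λ(σ̄))t} dσ)^{1/2}`. -/
def prefactor (lam : ℝ × ℝ → ℝ) (σbar : ℝ × ℝ) (c t : ℝ) : ℝ :=
  Real.sqrt (∫ σ in square σbar c, Real.exp (2 * (lam σ - lam σbar) * t))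

end RollInstability

end

/-!
The Fourier transform of a superposition of Bloch waves `e^{i(σ₁x + σ₂y)} W(x, σ)` is, in the
coordinates `(j, σ) ↦ (σ₁ + j, σ₂)` of the frequency plane, the `j`-th Fourier coefficient of
`W(·, σ)`; these coordinates are injective because the square has side at most one. When the
`W(·, σ)` are eigenfunctions, `e^{t𝓛}` multiplies them by `e^{λ(σ)t}`, and by Plancherel the squared
`H²` norm is the integral of `e^{2λ(σ)t} ‖W(·, σ)‖²_{H²}`, where the last factor is bounded above
and below. Other orbits are excluded by the energy estimate `Re ⟨𝓛v, v⟩ ≤ M ‖v‖²`.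

For the lower bound on `e(t)`, the symmetry of the Bloch operators gives
`(λ(σ) - λ(σ')) ⟨W_σ, W_{σ'}⟩ = ⟨W_σ, (B(σ) - B(σ')) W_{σ'}⟩`, so continuity of `W` alone yields
`λ(σ) - λ(σ') = O(|σ - σ'|)`. If `λ - λ_M = O(|σ - σ̄|^l)`, the square at `σ̄` of side of order
`(1 + t)^{-1/l}` contributes at least a multiple of its area to `e(t)²`.
-/

noncomputable section

namespace RollInstability

/-! ### Fourier coefficients of periodic functions -/

theorem intervalIntegral_deriv_mul_of_periodic {f g : ℝ → ℂ} {T : ℝ} (hf : ContDiff ℝ 1 f)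
    (hg : ContDiff ℝ 1 g) (hfg : Function.Periodic (fun x => f x * g x) T) :
    ∫ x in (0 : ℝ)..T, deriv f x * g x = -∫ x in (0 : ℝ)..T, f x * deriv g x := by
  have hparts := intervalIntegral.integral_mul_deriv_eq_deriv_mul (a := 0) (b := T) (u := f)
    (v := g) (fun x _ => (hf.differentiable one_ne_zero x).hasDerivAt)
    (fun x _ => (hg.differentiable one_ne_zero x).hasDerivAt)
    ((hf.continuous_deriv le_rfl).intervalIntegrable _ _)
    ((hg.continuous_deriv le_rfl).intervalIntegrable _ _)
  have hends : f T * g T = f 0 * g 0 := by simpa using hfg 0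
  linear_combination hparts + hends

theorem periodic_deriv {E : Type*} [NormedAddCommGroup E] [NormedSpace ℝ E] {f : ℝ → E} {T : ℝ}
    (hf : Function.Periodic f T) :
    Function.Periodic (deriv f) T := fun x => by
  rw [← deriv_comp_add_const, show (fun y => f (y + T)) = f from funext hf]

theorem exists_norm_le_of_periodic {E : Type*} [SeminormedAddCommGroup E] {f : ℝ → E} {T : ℝ}
    (hT : T ≠ 0) (hf : Continuous f) (hp : Function.Periodic f T) : ∃ C, ∀ x, ‖f x‖ ≤ C := by
  obtain ⟨C, hC⟩ := (hp.isBounded_of_continuous hT hf).exists_norm_le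
  exact ⟨C, fun x => hC _ ⟨x, rfl⟩⟩

theorem torusCoeff_add {f g : ℝ → ℂ} (hf : Continuous f) (hg : Continuous g) (j : ℤ) :
    torusCoeff (fun x => f x + g x) j = torusCoeff f j + torusCoeff g j := by
  unfold torusCoeff
  rw [← mul_add, ← intervalIntegral.integral_add]
  · simp only [mul_add]
  all_goals exact Continuous.intervalIntegrable (by fun_prop) _ _

theorem torusCoeff_const_mul (c : ℂ) (f : ℝ → ℂ) (j : ℤ) :
    torusCoeff (fun x => c * f x) j = c * torusCoeff f j := by
  unfold torusCoeff
  simp only [mul_left_comm _ c, intervalIntegral.integral_const_mul]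

theorem torusCoeff_sub {f g : ℝ → ℂ} (hf : Continuous f) (hg : Continuous g) (j : ℤ) :
    torusCoeff (fun x => f x - g x) j = torusCoeff f j - torusCoeff g j := by
  have hneg := torusCoeff_add hf (g := fun x => -1 * g x) (by fun_prop) j
  rw [torusCoeff_const_mul] at hneg
  simpa only [neg_one_mul, ← sub_eq_add_neg] using hneg

theorem norm_torusCoeff_le {f : ℝ → ℂ} {C : ℝ} (hC : ∀ x, ‖f x‖ ≤ C) (j : ℤ) :
    ‖torusCoeff f j‖ ≤ C := by
  have hint := intervalIntegral.norm_integral_le_of_norm_le_const (a := 0) (b := 2 * Real.pi)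
    (C := C) (f := fun x : ℝ => Complex.exp (-(Complex.I * j * x)) * f x) (fun x _ => by
      rw [norm_mul, Complex.norm_exp]
      simpa using hC x)
  rw [sub_zero, abs_of_pos Real.two_pi_pos] at hint
  have hnorm : ‖(1 / (2 * Real.pi : ℝ) : ℂ)‖ = (2 * Real.pi)⁻¹ := by
    rw [one_div, norm_inv, Complex.norm_real, Real.norm_of_nonneg Real.two_pi_pos.le]
  rw [torusCoeff, norm_mul, hnorm, inv_mul_le_iff₀ Real.two_pi_pos]
  linarith

theorem torusCoeff_deriv {f : ℝ → ℂ} (hf : ContDiff ℝ 1 f)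
    (hp : Function.Periodic f (2 * Real.pi)) (j : ℤ) :
    torusCoeff (deriv f) j = Complex.I * j * torusCoeff f j := by
  have hderiv (x : ℝ) : deriv (fun x : ℝ => Complex.exp (-(Complex.I * j * x))) x =
      -(Complex.I * j) * Complex.exp (-(Complex.I * j * x)) := by
    have hlin : HasDerivAt (fun x : ℝ => -(Complex.I * j * (x : ℂ))) (-(Complex.I * j)) x := by
      simpa using ((Complex.ofRealCLM.hasDerivAt (x := x)).const_mul (Complex.I * j)).fun_neg
    rw [hlin.cexp.deriv, mul_comm]
  have hper : Function.Periodic (fun x : ℝ => Complex.exp (-(Complex.I * j * x)))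
      (2 * Real.pi) := by
    intro x
    rw [Complex.exp_eq_exp_iff_exists_int]
    exact ⟨-j, by push_cast; ring⟩
  have hsmooth : ContDiff ℝ 1 (fun x : ℝ => Complex.exp (-(Complex.I * j * x))) :=
    Complex.contDiff_exp.comp (contDiff_const.mul Complex.ofRealCLM.contDiff).neg
  have hparts := intervalIntegral_deriv_mul_of_periodic hsmooth hf (hper.mul hp)
  simp only [hderiv, mul_assoc (-(Complex.I * (j : ℂ))),
    intervalIntegral.integral_const_mul] at hparts
  simp only [torusCoeff]
  linear_combination (1 / ((2 * Real.pi : ℝ) : ℂ)) * hparts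

theorem norm_one_add_sq (j : ℤ) : ‖(1 + (j : ℂ) ^ 2)‖ = 1 + (j : ℝ) ^ 2 := by
  have hreal : (1 + (j : ℂ) ^ 2) = ((1 + (j : ℝ) ^ 2 : ℝ) : ℂ) := by push_cast; ring
  rw [hreal, Complex.norm_real, Real.norm_of_nonneg (by positivity)]

theorem norm_torusCoeff_sub_deriv_deriv {f : ℝ → ℂ} (hf : ContDiff ℝ 2 f)
    (hp : Function.Periodic f (2 * Real.pi)) (j : ℤ) :
    ‖torusCoeff (fun x => f x - deriv (deriv f) x) j‖ =
      (1 + (j : ℝ) ^ 2) * ‖torusCoeff f j‖ := by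
  have hf' : ContDiff ℝ 1 (deriv f) := (contDiff_succ_iff_deriv.1 hf).2.2
  rw [torusCoeff_sub hf.continuous (hf'.continuous_deriv le_rfl),
    torusCoeff_deriv hf' (periodic_deriv hp), torusCoeff_deriv (hf.of_le one_le_two) hp,
    ← norm_one_add_sq, ← norm_mul]
  congr 1
  linear_combination -(j : ℂ) ^ 2 * torusCoeff f j * Complex.I_sq

theorem exists_norm_torusCoeff_le_of_contDiff (n : ℕ) {f : ℝ → ℂ}
    (hf : ContDiff ℝ (2 * n : ℕ) f) (hp : Function.Periodic f (2 * Real.pi)) :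
    ∃ C, ∀ j : ℤ, (1 + (j : ℝ) ^ 2) ^ n * ‖torusCoeff f j‖ ≤ C := by
  induction n generalizing f with
  | zero =>
    obtain ⟨C, hC⟩ := exists_norm_le_of_periodic Real.two_pi_pos.ne' hf.continuous hp
    exact ⟨C, fun j => by simpa using norm_torusCoeff_le hC j⟩
  | succ n ih =>
    have hf' : ContDiff ℝ (2 * n + 1 : ℕ) (deriv f) :=
      (contDiff_succ_iff_deriv (n := (2 * n + 1 : ℕ)).1 (mod_cast hf)).2.2
    have hf'' : ContDiff ℝ (2 * n : ℕ) (deriv (deriv f)) :=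
      (contDiff_succ_iff_deriv (n := (2 * n : ℕ)).1 (mod_cast hf')).2.2
    obtain ⟨C, hC⟩ := ih (f := fun x => f x - deriv (deriv f) x)
      ((hf.of_le (mod_cast by lia)).sub hf'') (hp.sub (periodic_deriv (periodic_deriv hp)))
    refine ⟨C, fun j => ?_⟩
    have hj := hC j
    rwa [norm_torusCoeff_sub_deriv_deriv (hf.of_le (mod_cast by lia)) hp, ← mul_assoc,
      ← pow_succ] at hj

theorem summable_inv_one_add_sq : Summable (fun j : ℤ => (1 + (j : ℝ) ^ 2)⁻¹) := by
  refine Summable.of_norm_bounded_eventually (Real.summable_one_div_int_pow.2 one_lt_two) ?_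
  filter_upwards [(Set.finite_singleton (0 : ℤ)).compl_mem_cofinite] with j hj
  have : (j : ℝ) ≠ 0 := mod_cast hj
  rw [Real.norm_of_nonneg (by positivity), one_div]
  gcongr
  linarith

theorem hasSum_torusCoeff {f : ℝ → ℂ} (hf : Continuous f)
    (hp : Function.Periodic f (2 * Real.pi)) (hs : Summable (torusCoeff f)) (x : ℝ) :
    HasSum (fun j : ℤ => torusCoeff f j * Complex.exp (Complex.I * j * x)) (f x) := by
  have : Fact (0 < 2 * Real.pi) := ⟨Real.two_pi_pos⟩
  let F : C(AddCircle (2 * Real.pi), ℂ) := ⟨hp.lift, continuous_coinduced_dom.mpr hf⟩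
  have hF (y : ℝ) : F (y : AddCircle (2 * Real.pi)) = f y := hp.lift_coe y
  have hpi : (Real.pi : ℂ) ≠ 0 := mod_cast Real.pi_ne_zero
  have hcoeff (j : ℤ) : fourierCoeff F j = torusCoeff f j := by
    rw [fourierCoeff_eq_intervalIntegral _ _ 0, torusCoeff, zero_add, Complex.real_smul]
    congr 1
    · push_cast; rfl
    · refine intervalIntegral.integral_congr fun y _ => ?_
      simp only [hF, fourier_coe_apply, smul_eq_mul]
      congr 2
      push_cast
      field_simp
  have hsum := has_pointwise_sum_fourier_series_of_summable (f := F) (by rwa [funext hcoeff])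
    (x : AddCircle (2 * Real.pi))
  simp only [hcoeff, hF, fourier_coe_apply, smul_eq_mul] at hsum
  convert hsum using 4 with j
  push_cast
  field_simp

theorem exists_torusCoeff_ne_zero {f : ℝ → ℂ} (hf : Continuous f)
    (hp : Function.Periodic f (2 * Real.pi)) (h0 : f ≠ 0) : ∃ j, torusCoeff f j ≠ 0 := by
  by_contra! hzero
  refine h0 (funext fun x => ?_)
  have hsum := hasSum_torusCoeff hf hp (by rw [funext hzero]; exact summable_zero) x
  simp only [hzero, zero_mul] at hsum
  exact hsum.unique hasSum_zero

theorem torusSobolevSq_ne_top_of_contDiff {n p : ℕ} (hpn : p + 1 ≤ 2 * n) {f : ℝ → ℂ}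
    (hf : ContDiff ℝ (2 * n : ℕ) f) (hp : Function.Periodic f (2 * Real.pi)) :
    torusSobolevSq p f ≠ ∞ := by
  obtain ⟨C, hC⟩ := exists_norm_torusCoeff_le_of_contDiff n hf hp
  have hle (j : ℤ) : (1 + (j : ℝ) ^ 2) ^ p * ‖torusCoeff f j‖ ^ 2 ≤
      C ^ 2 * (1 + (j : ℝ) ^ 2)⁻¹ := by
    rw [← div_eq_mul_inv, le_div_iff₀ (by positivity)]
    calc (1 + (j : ℝ) ^ 2) ^ p * ‖torusCoeff f j‖ ^ 2 * (1 + (j : ℝ) ^ 2)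
        = (1 + (j : ℝ) ^ 2) ^ (p + 1) * ‖torusCoeff f j‖ ^ 2 := by ring
      _ ≤ (1 + (j : ℝ) ^ 2) ^ (2 * n) * ‖torusCoeff f j‖ ^ 2 := by
        gcongr
        nlinarith
      _ = ((1 + (j : ℝ) ^ 2) ^ n * ‖torusCoeff f j‖) ^ 2 := by ring
      _ ≤ C ^ 2 := by
        gcongr
        exact hC j
  have hsum : Summable fun j : ℤ => (1 + (j : ℝ) ^ 2) ^ p * ‖torusCoeff f j‖ ^ 2 :=
    .of_nonneg_of_le (fun _ => by positivity) hle (summable_inv_one_add_sq.mul_left _)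
  rw [torusSobolevSq, ← ENNReal.ofReal_tsum_of_nonneg (fun _ => by positivity) hsum]
  exact ENNReal.ofReal_ne_top

theorem ofReal_mul_norm_torusCoeff_sq_le (p : ℕ) (f : ℝ → ℂ) (j : ℤ) :
    ENNReal.ofReal ((1 + (j : ℝ) ^ 2) ^ p * ‖torusCoeff f j‖ ^ 2) ≤ torusSobolevSq p f :=
  ENNReal.le_tsum j

theorem torusSobolevSq_pos {f : ℝ → ℂ} (hf : Continuous f)
    (hp : Function.Periodic f (2 * Real.pi)) (h0 : f ≠ 0) (p : ℕ) : 0 < torusSobolevSq p f := by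
  obtain ⟨j, hj⟩ := exists_torusCoeff_ne_zero hf hp h0
  refine lt_of_lt_of_le (ENNReal.ofReal_pos.2 ?_) (ofReal_mul_norm_torusCoeff_sq_le p f j)
  have := norm_pos_iff.2 hj
  positivity

theorem torusSobolevSq_const_mul (p : ℕ) (c : ℂ) (f : ℝ → ℂ) :
    torusSobolevSq p (fun x => c * f x) = ENNReal.ofReal (‖c‖ ^ 2) * torusSobolevSq p f := by
  rw [torusSobolevSq, torusSobolevSq, ← ENNReal.tsum_mul_left]
  refine tsum_congr fun j => ?_
  rw [← ENNReal.ofReal_mul (by positivity), torusCoeff_const_mul, norm_mul]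
  ring_nf

theorem torusSobolevSq_add_le {f g : ℝ → ℂ} (hf : Continuous f) (hg : Continuous g) (p : ℕ) :
    torusSobolevSq p (fun x => f x + g x) ≤ 2 * (torusSobolevSq p f + torusSobolevSq p g) := by
  rw [torusSobolevSq, torusSobolevSq, torusSobolevSq, ← ENNReal.tsum_add,
    ← ENNReal.tsum_mul_left]
  refine ENNReal.tsum_le_tsum fun j => ?_
  rw [← ENNReal.ofReal_add (by positivity) (by positivity), ← ENNReal.ofReal_ofNat 2,
    ← ENNReal.ofReal_mul zero_le_two, torusCoeff_add hf hg, ← mul_add, mul_left_comm]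
  gcongr
  calc ‖torusCoeff f j + torusCoeff g j‖ ^ 2
      ≤ (‖torusCoeff f j‖ + ‖torusCoeff g j‖) ^ 2 := by
        gcongr
        exact norm_add_le _ _
    _ ≤ 2 * (‖torusCoeff f j‖ ^ 2 + ‖torusCoeff g j‖ ^ 2) := add_sq_le

/-! ### Families of periodic functions -/

section ContinuousFamilyOn

variable {K : Set (ℝ × ℝ)} {W : ℝ × ℝ → ℝ → ℂ} {p : ℕ}

theorem ContinuousFamilyOn.continuousOn_torusCoeff (hc : ContinuousFamilyOn p W K)
    (hW : ∀ σ ∈ K, Continuous (W σ)) (j : ℤ) :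
    ContinuousOn (fun σ => torusCoeff (W σ) j) K := by
  intro σ₀ h₀
  have hsq : Tendsto (fun σ => ENNReal.ofReal (‖torusCoeff (W σ) j - torusCoeff (W σ₀) j‖ ^ 2))
      (𝓝[K] σ₀) (𝓝 0) := by
    refine tendsto_of_tendsto_of_tendsto_of_le_of_le' tendsto_const_nhds (hc σ₀ h₀)
      (Eventually.of_forall fun _ => zero_le) ?_
    filter_upwards [self_mem_nhdsWithin] with σ hσ
    rw [← torusCoeff_sub (hW σ hσ) (hW σ₀ h₀)]
    refine le_trans (ENNReal.ofReal_le_ofReal ?_) (ofReal_mul_norm_torusCoeff_sq_le p _ j)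
    exact le_mul_of_one_le_left (sq_nonneg _) (one_le_pow₀ (by nlinarith [sq_nonneg (j : ℝ)]))
  rw [ContinuousWithinAt, tendsto_iff_norm_sub_tendsto_zero]
  have hsqrt := (Real.continuous_sqrt.tendsto _).comp
    ((ENNReal.tendsto_toReal ENNReal.zero_ne_top).comp hsq)
  simpa [Function.comp_def, ENNReal.toReal_ofReal, Real.sqrt_sq] using hsqrt

theorem ContinuousFamilyOn.exists_torusSobolevSq_le (hc : ContinuousFamilyOn p W K)
    (hK : IsCompact K) (hW : ∀ σ ∈ K, Continuous (W σ))
    (hfin : ∀ σ ∈ K, torusSobolevSq p (W σ) ≠ ∞) :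
    ∃ B : NNReal, ∀ σ ∈ K, torusSobolevSq p (W σ) ≤ B := by
  have hlocal (σ₀) (h₀ : σ₀ ∈ K) :
      ∃ t ∈ 𝓝[K] σ₀, ∃ B : NNReal, ∀ σ ∈ t, torusSobolevSq p (W σ) ≤ B := by
    refine ⟨_, ((hc σ₀ h₀).eventually_le_const one_pos).and self_mem_nhdsWithin,
      (2 * (1 + torusSobolevSq p (W σ₀))).toNNReal, fun σ ⟨hσ, hσK⟩ => ?_⟩
    rw [ENNReal.coe_toNNReal (by finiteness [hfin σ₀ h₀])]
    calc torusSobolevSq p (W σ) = torusSobolevSq p (fun x => (W σ x - W σ₀ x) + W σ₀ x) := by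
          simp only [sub_add_cancel]
      _ ≤ 2 * (torusSobolevSq p (fun x => W σ x - W σ₀ x) + torusSobolevSq p (W σ₀)) :=
          torusSobolevSq_add_le ((hW σ hσK).sub (hW σ₀ h₀)) (hW σ₀ h₀) p
      _ ≤ 2 * (1 + torusSobolevSq p (W σ₀)) := by gcongr
  refine hK.induction_on ⟨0, by simp⟩ (fun s t hst ⟨B, hB⟩ => ⟨B, fun σ hσ => hB σ (hst hσ)⟩)
    (fun s t ⟨B, hB⟩ ⟨B', hB'⟩ => ⟨max B B', ?_⟩) hlocal
  rintro σ (hσ | hσ)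
  · exact (hB σ hσ).trans (mod_cast le_max_left B B')
  · exact (hB' σ hσ).trans (mod_cast le_max_right B B')

theorem ContinuousFamilyOn.exists_le_torusSobolevSq (hc : ContinuousFamilyOn p W K)
    (hK : IsCompact K) (hW : ∀ σ ∈ K, Continuous (W σ))
    (hp : ∀ σ ∈ K, Function.Periodic (W σ) (2 * Real.pi)) (h0 : ∀ σ ∈ K, W σ ≠ 0) :
    ∃ A : NNReal, 0 < A ∧ ∀ σ ∈ K, A ≤ torusSobolevSq p (W σ) := by
  rcases K.eq_empty_or_nonempty with rfl | hne
  · exact ⟨1, one_pos, by simp⟩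
  have hlsc : LowerSemicontinuousOn (fun σ => torusSobolevSq p (W σ)) K :=
    lowerSemicontinuousOn_tsum fun j => ContinuousOn.lowerSemicontinuousOn <|
      ENNReal.continuous_ofReal.comp_continuousOn <|
        ((hc.continuousOn_torusCoeff hW j).norm.pow 2).const_mul _
  obtain ⟨σ₀, h₀, hmin⟩ := hlsc.exists_isMinOn hne hK
  obtain ⟨A, hA, hA₀⟩ := ENNReal.lt_iff_exists_nnreal_btwn.1
    (torusSobolevSq_pos (hW σ₀ h₀) (hp σ₀ h₀) (h0 σ₀ h₀) p)
  exact ⟨A, mod_cast hA, fun σ hσ => hA₀.le.trans (hmin hσ)⟩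

end ContinuousFamilyOn

/-- A family of periodic functions on `K` for which the superposition of Bloch waves makes sense
and has square integrable Fourier transform: the Fourier coefficients are continuous in `σ` and
decay quadratically, uniformly in `σ`. It is stable under multiplication by a continuous function
of `σ`, so that the members of the family may be multiplied by `e^{λ(σ)t}`. -/
structure IsBlochFamilyOn (K : Set (ℝ × ℝ)) (W : ℝ × ℝ → ℝ → ℂ) : Prop where
  continuous : ∀ σ ∈ K, Continuous (W σ)
  periodic : ∀ σ ∈ K, Function.Periodic (W σ) (2 * Real.pi)
  continuousOn_torusCoeff : ∀ j, ContinuousOn (fun σ => torusCoeff (W σ) j) K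
  exists_norm_torusCoeff_le :
    ∃ D : ℝ, ∀ σ ∈ K, ∀ j : ℤ, ‖torusCoeff (W σ) j‖ ≤ D * (1 + (j : ℝ) ^ 2)⁻¹

theorem ContinuousFamilyOn.isBlochFamilyOn {K : Set (ℝ × ℝ)} {W : ℝ × ℝ → ℝ → ℂ}
    (hc : ContinuousFamilyOn 2 W K) (hK : IsCompact K) (hW : ∀ σ ∈ K, Continuous (W σ))
    (hp : ∀ σ ∈ K, Function.Periodic (W σ) (2 * Real.pi))
    (hfin : ∀ σ ∈ K, torusSobolevSq 2 (W σ) ≠ ∞) : IsBlochFamilyOn K W := by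
  refine ⟨hW, hp, hc.continuousOn_torusCoeff hW, ?_⟩
  obtain ⟨B, hB⟩ := hc.exists_torusSobolevSq_le hK hW hfin
  refine ⟨Real.sqrt B, fun σ hσ j => ?_⟩
  have hle := (ofReal_mul_norm_torusCoeff_sq_le 2 (W σ) j).trans (hB σ hσ)
  rw [← mul_pow, ENNReal.ofReal_le_coe] at hle
  rw [← div_eq_mul_inv, le_div_iff₀ (by positivity), mul_comm]
  exact Real.le_sqrt_of_sq_le hle

section IsBlochFamilyOn

variable {K : Set (ℝ × ℝ)} {W : ℝ × ℝ → ℝ → ℂ}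

theorem IsBlochFamilyOn.mul (hW : IsBlochFamilyOn K W) (hK : IsCompact K) {A : ℝ × ℝ → ℂ}
    (hA : ContinuousOn A K) : IsBlochFamilyOn K (fun σ x => A σ * W σ x) where
  continuous σ hσ := continuous_const.mul (hW.continuous σ hσ)
  periodic σ hσ x := congrArg (A σ * ·) (hW.periodic σ hσ x)
  continuousOn_torusCoeff j := by
    simp only [torusCoeff_const_mul]
    exact hA.mul (hW.continuousOn_torusCoeff j)
  exists_norm_torusCoeff_le := by
    obtain ⟨D, hD⟩ := hW.exists_norm_torusCoeff_le
    obtain ⟨M, hM⟩ := hK.exists_bound_of_continuousOn hA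
    refine ⟨M * D, fun σ hσ j => ?_⟩
    rw [torusCoeff_const_mul, norm_mul, mul_assoc]
    exact mul_le_mul (hM σ hσ) (hD σ hσ j) (norm_nonneg _) ((norm_nonneg _).trans (hM σ hσ))

theorem norm_exp_I_mul_int_mul (j : ℤ) (x : ℝ) : ‖Complex.exp (Complex.I * j * x)‖ = 1 := by
  rw [Complex.norm_exp]
  simp

theorem IsBlochFamilyOn.hasSum (hW : IsBlochFamilyOn K W) {σ : ℝ × ℝ} (hσ : σ ∈ K) (x : ℝ) :
    HasSum (fun j : ℤ => torusCoeff (W σ) j * Complex.exp (Complex.I * j * x)) (W σ x) := by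
  obtain ⟨D, hD⟩ := hW.exists_norm_torusCoeff_le
  exact hasSum_torusCoeff (hW.continuous σ hσ) (hW.periodic σ hσ)
    (.of_norm_bounded (summable_inv_one_add_sq.mul_left D) (hD σ hσ)) x

theorem IsBlochFamilyOn.continuousOn_uncurry (hW : IsBlochFamilyOn K W) :
    ContinuousOn (fun z : (ℝ × ℝ) × ℝ => W z.1 z.2) (K ×ˢ Set.univ) := by
  obtain ⟨D, hD⟩ := hW.exists_norm_torusCoeff_le
  have hseries : ContinuousOn (fun z : (ℝ × ℝ) × ℝ =>
      ∑' j : ℤ, torusCoeff (W z.1) j * Complex.exp (Complex.I * j * z.2)) (K ×ˢ Set.univ) := by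
    refine continuousOn_tsum (fun j => ?_) (summable_inv_one_add_sq.mul_left D) fun j z hz => ?_
    · exact ((hW.continuousOn_torusCoeff j).comp continuousOn_fst fun z hz => hz.1).mul
        (by fun_prop)
    · rw [norm_mul, norm_exp_I_mul_int_mul, mul_one]
      exact hD z.1 hz.1 j
  exact hseries.congr fun z hz => (hW.hasSum hz.1 z.2).tsum_eq.symm

theorem IsBlochFamilyOn.exists_norm_le (hW : IsBlochFamilyOn K W) :
    ∃ M, ∀ σ ∈ K, ∀ x, ‖W σ x‖ ≤ M := by
  obtain ⟨D, hD⟩ := hW.exists_norm_torusCoeff_le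
  refine ⟨∑' j : ℤ, D * (1 + (j : ℝ) ^ 2)⁻¹, fun σ hσ x => ?_⟩
  rw [← (hW.hasSum hσ x).tsum_eq]
  refine tsum_of_norm_bounded (summable_inv_one_add_sq.mul_left D).hasSum fun j => ?_
  rw [norm_mul, norm_exp_I_mul_int_mul, mul_one]
  exact hD σ hσ j

end IsBlochFamilyOn

/-! ### Symmetry of the Bloch operators and regularity of the eigenvalue -/

theorem contDiff_blochDeriv {n : ℕ} {f : ℝ → ℂ} (hf : ContDiff ℝ (n + 1 : ℕ) f) (σ : ℝ × ℝ) :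
    ContDiff ℝ n (blochDeriv σ f) :=
  (contDiff_succ_iff_deriv (n := n).1 (mod_cast hf)).2.2.add
    (contDiff_const.mul (hf.of_le (mod_cast n.le_succ)))

theorem periodic_blochDeriv {f : ℝ → ℂ} {T : ℝ} (hf : Function.Periodic f T) (σ : ℝ × ℝ) :
    Function.Periodic (blochDeriv σ f) T := fun x => by
  simp only [blochDeriv, periodic_deriv hf x, hf x]

theorem contDiff_blochInner {n : ℕ} {f : ℝ → ℂ} (hf : ContDiff ℝ (n + 2 : ℕ) f) (ε ω : ℝ)
    (σ : ℝ × ℝ) : ContDiff ℝ n (blochInner ε ω σ f) := by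
  have hf₀ : ContDiff ℝ n f := hf.of_le (mod_cast n.le_add_right 2)
  have hf₂ : ContDiff ℝ n (blochDeriv σ (blochDeriv σ f)) :=
    contDiff_blochDeriv (contDiff_blochDeriv (n := n + 1) hf σ) σ
  exact (hf₀.add (contDiff_const.mul hf₂)).sub (contDiff_const.mul hf₀)

theorem periodic_blochInner {f : ℝ → ℂ} {T : ℝ} (hf : Function.Periodic f T) (ε ω : ℝ)
    (σ : ℝ × ℝ) : Function.Periodic (blochInner ε ω σ f) T := fun x => by
  simp only [blochInner, periodic_blochDeriv (periodic_blochDeriv hf σ) σ x, hf x]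

theorem continuous_potential {u : ℝ → ℝ} (hu : Continuous u) (ε b s : ℝ) :
    Continuous (potential ε b s u) := by
  unfold potential
  fun_prop

theorem exists_abs_potential_le {u : ℝ → ℝ} (hu : Continuous u)
    (hup : Function.Periodic u (2 * Real.pi)) (ε b s : ℝ) :
    ∃ M, ∀ x, |potential ε b s u x| ≤ M :=
  exists_norm_le_of_periodic Real.two_pi_pos.ne' (continuous_potential hu ε b s) fun x => by
    simp only [potential, hup x]

/-- The inner product `∫₀^{2π} f ḡ` of `L²(𝕋)`, linear in the first argument. -/
def torusInner (f g : ℝ → ℂ) : ℂ :=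
  ∫ x in (0 : ℝ)..(2 * Real.pi), f x * star (g x)

theorem torusInner_star (f g : ℝ → ℂ) : star (torusInner f g) = torusInner g f := by
  rw [torusInner, torusInner, Complex.star_def, ← intervalIntegral.intervalIntegral_conj]
  simp [mul_comm]

theorem torusInner_const_mul (a : ℂ) (f g : ℝ → ℂ) :
    torusInner (fun x => a * f x) g = a * torusInner f g := by
  simp only [torusInner, mul_assoc, intervalIntegral.integral_const_mul]

theorem torusInner_add_const_mul {f g h : ℝ → ℂ} (hf : Continuous f) (hg : Continuous g)
    (hh : Continuous h) (a : ℂ) :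
    torusInner (fun x => f x + a * g x) h = torusInner f h + a * torusInner g h := by
  simp only [torusInner, add_mul, mul_assoc]
  rw [intervalIntegral.integral_add, intervalIntegral.integral_const_mul]
  all_goals exact Continuous.intervalIntegrable (by fun_prop) _ _

theorem torusInner_right_add_const_mul {f g h : ℝ → ℂ} (hf : Continuous f) (hg : Continuous g)
    (hh : Continuous h) (a : ℂ) :
    torusInner f (fun x => g x + a * h x) = torusInner f g + star a * torusInner f h := by
  rw [← torusInner_star, torusInner_add_const_mul hg hh hf, star_add, star_mul',
    torusInner_star, torusInner_star]

theorem torusInner_self {f : ℝ → ℂ} :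
    torusInner f f = ((∫ x in (0 : ℝ)..(2 * Real.pi), ‖f x‖ ^ 2 : ℝ) : ℂ) := by
  rw [torusInner, ← intervalIntegral.integral_ofReal]
  simp only [Complex.star_def, Complex.mul_conj, Complex.normSq_eq_norm_sq]

theorem torusInner_self_ne_zero {f : ℝ → ℂ} (hf : Continuous f)
    (hp : Function.Periodic f (2 * Real.pi)) (h0 : f ≠ 0) : torusInner f f ≠ 0 := by
  obtain ⟨y, hy⟩ := Function.ne_iff.1 h0
  obtain ⟨z, hz, hyz⟩ := hp.exists_mem_Ico₀ Real.two_pi_pos y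
  have hpos : 0 < ‖f z‖ ^ 2 := pow_pos (norm_pos_iff.2 (hyz ▸ hy)) 2
  rw [torusInner_self]
  exact mod_cast (intervalIntegral.integral_pos Real.two_pi_pos (by fun_prop)
    (fun x _ => by positivity) ⟨z, Set.Ico_subset_Icc_self hz, hpos⟩).ne'

theorem norm_torusInner_le {f g : ℝ → ℂ} {C D : ℝ} (hf : ∀ x, ‖f x‖ ≤ C)
    (hg : ∀ x, ‖g x‖ ≤ D) : ‖torusInner f g‖ ≤ C * D * (2 * Real.pi) := by
  have hle := intervalIntegral.norm_integral_le_of_norm_le_const (a := 0) (b := 2 * Real.pi)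
    (f := fun x => f x * star (g x)) (C := C * D) fun x _ => by
      rw [norm_mul, norm_star]
      exact mul_le_mul (hf x) (hg x) (norm_nonneg _) ((norm_nonneg _).trans (hf x))
  rwa [sub_zero, abs_of_pos Real.two_pi_pos] at hle

theorem torusInner_deriv {f g : ℝ → ℂ} (hf : ContDiff ℝ 1 f) (hg : ContDiff ℝ 1 g)
    (hfp : Function.Periodic f (2 * Real.pi)) (hgp : Function.Periodic g (2 * Real.pi)) :
    torusInner (deriv f) g = -torusInner f (deriv g) := by
  have hparts := intervalIntegral_deriv_mul_of_periodic (T := 2 * Real.pi) hf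
    ((starL' ℝ (A := ℂ)).contDiff.comp hg) (fun x => by simp [hfp x, hgp x])
  have hstar (x : ℝ) : deriv (starL' ℝ (A := ℂ) ∘ g) x = star (deriv g x) := deriv.star ..
  simp only [hstar, Function.comp_apply] at hparts
  exact hparts

theorem torusInner_blochDeriv {f g : ℝ → ℂ} (hf : ContDiff ℝ 1 f) (hg : ContDiff ℝ 1 g)
    (hfp : Function.Periodic f (2 * Real.pi)) (hgp : Function.Periodic g (2 * Real.pi))
    (σ : ℝ × ℝ) : torusInner (blochDeriv σ f) g = -torusInner f (blochDeriv σ g) := by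
  have hleft : torusInner (blochDeriv σ f) g =
      torusInner (deriv f) g + Complex.I * σ.1 * torusInner f g :=
    torusInner_add_const_mul (hf.continuous_deriv le_rfl) hf.continuous hg.continuous _
  have hright : torusInner f (blochDeriv σ g) =
      torusInner f (deriv g) + star (Complex.I * σ.1) * torusInner f g :=
    torusInner_right_add_const_mul hf.continuous (hg.continuous_deriv le_rfl) hg.continuous _
  rw [hleft, hright, torusInner_deriv hf hg hfp hgp]
  simp only [star_mul', Complex.star_def, Complex.conj_I, Complex.conj_ofReal]
  ring

theorem torusInner_blochInner {f g : ℝ → ℂ} (hf : ContDiff ℝ 2 f) (hg : ContDiff ℝ 2 g)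
    (hfp : Function.Periodic f (2 * Real.pi)) (hgp : Function.Periodic g (2 * Real.pi))
    (ε ω : ℝ) (σ : ℝ × ℝ) :
    torusInner (blochInner ε ω σ f) g = torusInner f (blochInner ε ω σ g) := by
  have hDf : ContDiff ℝ (1 : ℕ) (blochDeriv σ f) := contDiff_blochDeriv (mod_cast hf) σ
  have hDg : ContDiff ℝ (1 : ℕ) (blochDeriv σ g) := contDiff_blochDeriv (mod_cast hg) σ
  have hDDf := (contDiff_blochDeriv (n := 0) hDf σ).continuous
  have hDDg := (contDiff_blochDeriv (n := 0) hDg σ).continuous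
  have hfc := hf.continuous
  have hgc := hg.continuous
  have hD : torusInner (blochDeriv σ (blochDeriv σ f)) g =
      torusInner f (blochDeriv σ (blochDeriv σ g)) := by
    rw [torusInner_blochDeriv (mod_cast hDf) (hg.of_le one_le_two) (periodic_blochDeriv hfp σ) hgp,
      torusInner_blochDeriv (hf.of_le one_le_two) (mod_cast hDg) hfp (periodic_blochDeriv hgp σ),
      neg_neg]
  have hsum (h : ℝ → ℂ) : blochInner ε ω σ h = fun x =>
      (h x + ((1 + 2 * ε * ω : ℝ) : ℂ) * blochDeriv σ (blochDeriv σ h) x) +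
        ((-σ.2 ^ 2 : ℝ) : ℂ) * h x := by
    funext x
    simp only [blochInner]
    push_cast
    ring
  rw [hsum f, hsum g, torusInner_add_const_mul (by fun_prop) hfc hgc,
    torusInner_add_const_mul hfc hDDf hgc, torusInner_right_add_const_mul hfc (by fun_prop) hgc,
    torusInner_right_add_const_mul hfc hgc hDDg, hD]
  simp only [Complex.star_def, Complex.conj_ofReal]

theorem torusInner_blochOp {u : ℝ → ℝ} (hu : Continuous u) {f g : ℝ → ℂ}
    (hf : ContDiff ℝ 4 f) (hg : ContDiff ℝ 4 g)
    (hfp : Function.Periodic f (2 * Real.pi)) (hgp : Function.Periodic g (2 * Real.pi))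
    (ε ω b s : ℝ) (σ : ℝ × ℝ) :
    torusInner (blochOp ε ω b s u σ f) g = torusInner f (blochOp ε ω b s u σ g) := by
  have hPf : ContDiff ℝ (2 : ℕ) (blochInner ε ω σ f) := contDiff_blochInner (mod_cast hf) ε ω σ
  have hPg : ContDiff ℝ (2 : ℕ) (blochInner ε ω σ g) := contDiff_blochInner (mod_cast hg) ε ω σ
  have hPPf := (contDiff_blochInner (n := 0) hPf ε ω σ).continuous
  have hPPg := (contDiff_blochInner (n := 0) hPg ε ω σ).continuous
  have hq : Continuous fun x => (potential ε b s u x : ℂ) :=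
    Complex.continuous_ofReal.comp (continuous_potential hu ε b s)
  have hfc := hf.continuous
  have hgc := hg.continuous
  have hP : torusInner (blochInner ε ω σ (blochInner ε ω σ f)) g =
      torusInner f (blochInner ε ω σ (blochInner ε ω σ g)) := by
    rw [torusInner_blochInner (mod_cast hPf) (hg.of_le (by norm_num))
        (periodic_blochInner hfp ε ω σ) hgp,
      torusInner_blochInner (hf.of_le (by norm_num)) (mod_cast hPg) hfp
        (periodic_blochInner hgp ε ω σ)]
  have hpot : torusInner (fun x => (potential ε b s u x : ℂ) * f x) g =
      torusInner f (fun x => (potential ε b s u x : ℂ) * g x) := by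
    simp [torusInner, mul_assoc, mul_left_comm]
  have hsum (h : ℝ → ℂ) : blochOp ε ω b s u σ h = fun x => (potential ε b s u x : ℂ) * h x +
      ((-1 : ℝ) : ℂ) * blochInner ε ω σ (blochInner ε ω σ h) x := by
    funext x
    simp only [blochOp]
    push_cast
    ring
  rw [hsum f, hsum g, torusInner_add_const_mul (by fun_prop) hPPf hgc,
    torusInner_right_add_const_mul hfc (by fun_prop) hPPg, hP, hpot, Complex.star_def,
    Complex.conj_ofReal]

theorem IsBlochFamilyOn.continuousOn_torusInner {K : Set (ℝ × ℝ)} {W : ℝ × ℝ → ℝ → ℂ}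
    (hW : IsBlochFamilyOn K W) {g : ℝ → ℂ} (hg : Continuous g) :
    ContinuousOn (fun σ => torusInner (W σ) g) K := by
  obtain ⟨M, hM⟩ := hW.exists_norm_le
  intro σ₀ h₀
  refine intervalIntegral.continuousWithinAt_of_dominated_interval (bound := fun x => M * ‖g x‖)
    ?_ ?_ (Continuous.intervalIntegrable (by fun_prop) _ _) (.of_forall fun x _ => ?_)
  · filter_upwards [self_mem_nhdsWithin] with σ hσ
    exact ((hW.continuous σ hσ).mul hg.star).aestronglyMeasurable
  · filter_upwards [self_mem_nhdsWithin] with σ hσ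
    refine .of_forall fun x _ => ?_
    rw [norm_mul, norm_star]
    gcongr
    exact hM σ hσ x
  · exact ((hW.continuousOn_uncurry (σ₀, x) ⟨h₀, trivial⟩).comp (f := fun σ => (σ, x))
      (by fun_prop) fun σ hσ => ⟨hσ, trivial⟩).mul continuousWithinAt_const

theorem blochInner_eq {f : ℝ → ℂ} (hf : ContDiff ℝ 2 f) (ε ω : ℝ) (σ : ℝ × ℝ) :
    blochInner ε ω σ f = fun x =>
      (1 - ((1 + 2 * ε * ω : ℝ) : ℂ) * (σ.1 : ℂ) ^ 2 - (σ.2 : ℂ) ^ 2) * f x +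
      (2 * Complex.I * ((1 + 2 * ε * ω : ℝ) : ℂ) * σ.1) * deriv f x +
      ((1 + 2 * ε * ω : ℝ) : ℂ) * deriv (deriv f) x := by
  have hf₁ : Differentiable ℝ f := hf.differentiable two_ne_zero
  have hf₂ : Differentiable ℝ (deriv f) :=
    (contDiff_succ_iff_deriv (n := 1).1 hf).2.2.differentiable one_ne_zero
  have hderiv (x : ℝ) :
      deriv (blochDeriv σ f) x = deriv (deriv f) x + Complex.I * σ.1 * deriv f x :=
    ((hf₂ x).hasDerivAt.add ((hf₁ x).hasDerivAt.const_mul _)).deriv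
  funext x
  rw [blochInner, blochDeriv, hderiv, blochDeriv]
  linear_combination ((1 + 2 * ε * ω : ℝ) : ℂ) * (σ.1 : ℂ) ^ 2 * f x * Complex.I_sq

theorem deriv_linear_combination {a b c : ℂ} {f g h : ℝ → ℂ} (hf : Differentiable ℝ f)
    (hg : Differentiable ℝ g) (hh : Differentiable ℝ h) :
    deriv (fun x => a * f x + b * g x + c * h x) =
      fun x => a * deriv f x + b * deriv g x + c * deriv h x := by
  funext x
  exact ((((hf x).hasDerivAt.const_mul a).add ((hg x).hasDerivAt.const_mul b)).add
    ((hh x).hasDerivAt.const_mul c)).deriv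

theorem exists_blochOp_eq_sum (ε ω : ℝ) : ∃ a : Fin 5 → ℝ × ℝ → ℂ, (∀ k, Differentiable ℝ (a k)) ∧
    ∀ (b s : ℝ) (u : ℝ → ℝ) (w : ℝ → ℂ), ContDiff ℝ 4 w → ∀ σ x,
      blochOp ε ω b s u σ w x =
        (potential ε b s u x : ℂ) * w x + ∑ k, a k σ * iteratedDeriv k w x := by
  let κ : ℂ := ((1 + 2 * ε * ω : ℝ) : ℂ)
  let α : ℝ × ℝ → ℂ := fun σ => 1 - κ * (σ.1 : ℂ) ^ 2 - (σ.2 : ℂ) ^ 2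
  let β : ℝ × ℝ → ℂ := fun σ => 2 * Complex.I * κ * σ.1
  have hfst : Differentiable ℝ (fun σ : ℝ × ℝ => (σ.1 : ℂ)) :=
    (Complex.ofRealCLM.comp (ContinuousLinearMap.fst ℝ ℝ ℝ)).differentiable
  have hsnd : Differentiable ℝ (fun σ : ℝ × ℝ => (σ.2 : ℂ)) :=
    (Complex.ofRealCLM.comp (ContinuousLinearMap.snd ℝ ℝ ℝ)).differentiable
  have hα : Differentiable ℝ α := by fun_prop
  have hβ : Differentiable ℝ β := by fun_prop
  refine ⟨![fun σ => -α σ ^ 2, fun σ => -(2 * α σ * β σ), fun σ => -(2 * α σ * κ + β σ ^ 2),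
    fun σ => -(2 * β σ * κ), fun _ => -κ ^ 2], fun k => ?_, fun b s u w hw σ x => ?_⟩
  · fin_cases k <;> simp only [Fin.reduceFinMk, Matrix.cons_val] <;> fun_prop
  · have hP (f : ℝ → ℂ) (hf : ContDiff ℝ 2 f) : blochInner ε ω σ f =
        fun x => α σ * f x + β σ * deriv f x + κ * deriv (deriv f) x := blochInner_eq hf ε ω σ
    have hw₃ : ContDiff ℝ 3 (deriv w) := (contDiff_succ_iff_deriv (n := 3).1 hw).2.2
    have hw₂ : ContDiff ℝ 2 (deriv (deriv w)) := (contDiff_succ_iff_deriv (n := 2).1 hw₃).2.2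
    have hw₁ : ContDiff ℝ 1 (deriv (deriv (deriv w))) :=
      (contDiff_succ_iff_deriv (n := 1).1 hw₂).2.2
    have hw₀' := hw.differentiable (by norm_num)
    have hw₁' := hw₃.differentiable (by norm_num)
    have hw₂' := hw₂.differentiable (by norm_num)
    rw [blochOp, hP _ (contDiff_blochInner (n := 2) (mod_cast hw) ε ω σ),
      hP w (hw.of_le (by norm_num)), deriv_linear_combination hw₀' hw₁' hw₂',
      deriv_linear_combination hw₁' hw₂' (hw₁.differentiable one_ne_zero)]
    simp only [Fin.sum_univ_five, Matrix.cons_val, Fin.coe_ofNat_eq_mod, Nat.reduceMod,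
      iteratedDeriv_succ, iteratedDeriv_zero]
    ring

theorem periodic_iteratedDeriv {E : Type*} [NormedAddCommGroup E] [NormedSpace ℝ E] {f : ℝ → E}
    {T : ℝ} (hf : Function.Periodic f T) (k : ℕ) : Function.Periodic (iteratedDeriv k f) T := by
  induction k with
  | zero => simpa only [iteratedDeriv_zero]
  | succ k ih => simpa only [iteratedDeriv_succ] using periodic_deriv ih

theorem exists_norm_blochOp_sub_le {w : ℝ → ℂ} (hw : ContDiff ℝ 4 w)
    (hp : Function.Periodic w (2 * Real.pi)) (ε ω b s : ℝ) (u : ℝ → ℝ) (σ₀ : ℝ × ℝ) :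
    ∃ C, ∀ᶠ σ in 𝓝 σ₀, ∀ x,
      ‖blochOp ε ω b s u σ w x - blochOp ε ω b s u σ₀ w x‖ ≤ C * ‖σ - σ₀‖ := by
  obtain ⟨a, ha, heq⟩ := exists_blochOp_eq_sum ε ω
  have hbound (k : Fin 5) : ∃ C, ∀ x, ‖iteratedDeriv k w x‖ ≤ C :=
    exists_norm_le_of_periodic Real.two_pi_pos.ne'
      (hw.continuous_iteratedDeriv k (mod_cast k.is_le)) (periodic_iteratedDeriv hp k)
  choose C hC using hbound
  have hlip (k : Fin 5) : ∃ L, ∀ᶠ σ in 𝓝 σ₀, ‖a k σ - a k σ₀‖ ≤ L * ‖σ - σ₀‖ :=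
    ((ha k).differentiableAt.isBigO_sub).bound
  choose L hL using hlip
  refine ⟨∑ k, L k * C k, ?_⟩
  filter_upwards [eventually_all.2 hL] with σ hσ x
  rw [heq b s u w hw, heq b s u w hw, add_sub_add_left_eq_sub, ← Finset.sum_sub_distrib,
    Finset.sum_mul]
  refine norm_sum_le_of_le _ fun k _ => ?_
  rw [← sub_mul, norm_mul, mul_right_comm]
  exact mul_le_mul (hσ k) (hC k x) (norm_nonneg _) ((norm_nonneg _).trans (hσ k))

theorem eigenvalue_sub_mul_torusInner {ε ω b s : ℝ} {u : ℝ → ℝ} (hu : Continuous u)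
    {σ σ₀ : ℝ × ℝ} {μ μ₀ : ℝ} {v w : ℝ → ℂ} (hv : IsBlochEigenfunction ε ω b s u σ μ v)
    (hw : IsBlochEigenfunction ε ω b s u σ₀ μ₀ w) :
    ((μ - μ₀ : ℝ) : ℂ) * torusInner v w =
      torusInner v (fun x => blochOp ε ω b s u σ w x - blochOp ε ω b s u σ₀ w x) := by
  obtain ⟨hvd, hvp, -, hve⟩ := hv
  obtain ⟨hwd, hwp, -, hwe⟩ := hw
  have hsymm := torusInner_blochOp hu hvd hwd hvp hwp ε ω b s σ
  have hcont : Continuous (blochOp ε ω b s u σ w) := by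
    have hP : ContDiff ℝ (2 : ℕ) (blochInner ε ω σ w) := contDiff_blochInner (mod_cast hwd) ε ω σ
    have := (contDiff_blochInner (n := 0) hP ε ω σ).continuous
    have := continuous_potential hu ε b s
    have := hwd.continuous
    unfold blochOp
    fun_prop
  have hright : torusInner v (fun x => blochOp ε ω b s u σ w x + (-μ₀ : ℂ) * w x) =
      torusInner v (blochOp ε ω b s u σ w) + star (-μ₀ : ℂ) * torusInner v w :=
    torusInner_right_add_const_mul hvd.continuous hcont hwd.continuous _
  simp only [hwe, sub_eq_add_neg, ← neg_mul]
  rw [hright, ← hsymm, funext hve, torusInner_const_mul]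
  simp only [star_neg, Complex.star_def, Complex.conj_ofReal]
  push_cast
  ring

theorem eigenvalue_sub_isBigO {ε ω b s : ℝ} {u : ℝ → ℝ} (hu : Continuous u) {K : Set (ℝ × ℝ)}
    {lam : ℝ × ℝ → ℝ} {W : ℝ × ℝ → ℝ → ℂ}
    (hW : ∀ σ ∈ K, IsBlochEigenfunction ε ω b s u σ (lam σ) (W σ)) (hWK : IsBlochFamilyOn K W)
    {σ₀ : ℝ × ℝ} (h₀ : σ₀ ∈ K) :
    (fun σ => lam σ - lam σ₀) =O[𝓝[K] σ₀] (fun σ => σ - σ₀) := by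
  obtain ⟨hd, hp, hne, -⟩ := hW σ₀ h₀
  obtain ⟨C, hC⟩ := exists_norm_blochOp_sub_le hd hp ε ω b s u σ₀
  obtain ⟨M, hM⟩ := hWK.exists_norm_le
  have hinner := (hWK.continuousOn_torusInner hd.continuous) σ₀ h₀
  have hinner₀ := torusInner_self_ne_zero hd.continuous hp hne
  have hprod : (fun σ => ((lam σ - lam σ₀ : ℝ) : ℂ) * torusInner (W σ) (W σ₀))
      =O[𝓝[K] σ₀] (fun σ => ‖σ - σ₀‖) := by
    refine .of_bound (M * C * (2 * Real.pi)) ?_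
    filter_upwards [self_mem_nhdsWithin, nhdsWithin_le_nhds hC] with σ hσ hCσ
    rw [eigenvalue_sub_mul_torusInner hu (hW σ hσ) (hW σ₀ h₀), norm_norm]
    exact (norm_torusInner_le (hM σ hσ) hCσ).trans_eq (by ring)
  have hinv : (fun σ => (torusInner (W σ) (W σ₀))⁻¹) =O[𝓝[K] σ₀] (fun _ => (1 : ℝ)) :=
    (hinner.tendsto.inv₀ hinner₀).isBigO_one ℝ
  rw [← Asymptotics.isBigO_norm_right]
  refine .trans (.of_bound 1 ?_) ((hprod.mul hinv).congr_right fun _ => mul_one _)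
  filter_upwards [hinner.tendsto.eventually_ne hinner₀] with σ hσ
  rw [mul_inv_cancel_right₀ hσ, Complex.norm_real, one_mul]

theorem continuousOn_eigenvalue {ε ω b s : ℝ} {u : ℝ → ℝ} (hu : Continuous u) {K : Set (ℝ × ℝ)}
    {lam : ℝ × ℝ → ℝ} {W : ℝ × ℝ → ℝ → ℂ}
    (hW : ∀ σ ∈ K, IsBlochEigenfunction ε ω b s u σ (lam σ) (W σ)) (hWK : IsBlochFamilyOn K W) :
    ContinuousOn lam K := by
  intro σ₀ h₀
  rw [ContinuousWithinAt, ← tendsto_sub_nhds_zero_iff]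
  refine (eigenvalue_sub_isBigO hu hW hWK h₀).trans_tendsto ?_
  exact (by fun_prop : Continuous fun σ : ℝ × ℝ => σ - σ₀).tendsto' σ₀ 0 (sub_self σ₀)
    |>.mono_left nhdsWithin_le_nhds

/-! ### The prefactor -/

theorem isCompact_square (σbar : ℝ × ℝ) (c : ℝ) : IsCompact (square σbar c) :=
  isCompact_Icc.prod isCompact_Icc

theorem mem_square_self (σbar : ℝ × ℝ) {c : ℝ} (hc : 0 ≤ c) : σbar ∈ square σbar c :=
  ⟨⟨le_rfl, by linarith⟩, ⟨le_rfl, by linarith⟩⟩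

theorem square_subset (σbar : ℝ × ℝ) {r c : ℝ} (h : r ≤ c) : square σbar r ⊆ square σbar c :=
  Set.prod_mono (Set.Icc_subset_Icc_right (by linarith)) (Set.Icc_subset_Icc_right (by linarith))

theorem norm_sub_le_of_mem_square {σbar σ : ℝ × ℝ} {r : ℝ} (h : σ ∈ square σbar r) :
    ‖σ - σbar‖ ≤ r := by
  obtain ⟨⟨h₁, h₁'⟩, ⟨h₂, h₂'⟩⟩ := h
  rw [Prod.norm_def, Prod.fst_sub, Prod.snd_sub, Real.norm_eq_abs, Real.norm_eq_abs]
  exact max_le (abs_le.2 ⟨by linarith, by linarith⟩) (abs_le.2 ⟨by linarith, by linarith⟩)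

theorem volume_real_square (σbar : ℝ × ℝ) {c : ℝ} (hc : 0 ≤ c) :
    (volume : Measure (ℝ × ℝ)).real (square σbar c) = c ^ 2 := by
  rw [Measure.real, square, Measure.volume_eq_prod, Measure.prod_prod, Real.volume_Icc,
    Real.volume_Icc, ENNReal.toReal_mul, add_sub_cancel_left, add_sub_cancel_left,
    ENNReal.toReal_ofReal hc, sq]

theorem integrableOn_exp_eigenvalue {lam : ℝ × ℝ → ℝ} {K : Set (ℝ × ℝ)} (hK : IsCompact K)
    (hl : ContinuousOn lam K) (a t : ℝ) :
    IntegrableOn (fun σ => Real.exp (2 * (lam σ - a) * t)) K :=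
  ContinuousOn.integrableOn_compact hK (by fun_prop)

theorem prefactor_le {lam : ℝ × ℝ → ℝ} {σbar : ℝ × ℝ} {c : ℝ} (hc : 0 ≤ c)
    (hl : ContinuousOn lam (square σbar c)) (hle : ∀ σ ∈ square σbar c, lam σ ≤ lam σbar)
    {t : ℝ} (ht : 0 ≤ t) : prefactor lam σbar c t ≤ c := by
  have hcpt := isCompact_square σbar c
  refine Real.sqrt_le_iff.2 ⟨hc, ?_⟩
  calc _ ≤ ∫ _ in square σbar c, (1 : ℝ) := by
        refine setIntegral_mono_on (integrableOn_exp_eigenvalue hcpt hl _ t)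
          (integrableOn_const hcpt.measure_ne_top) hcpt.measurableSet fun σ hσ => ?_
        rw [Real.exp_le_one_iff]
        nlinarith [hle σ hσ]
    _ = c ^ 2 := by
        rw [setIntegral_const, volume_real_square σbar hc, smul_eq_mul, mul_one]

theorem exp_neg_mul_le_prefactor {lam : ℝ × ℝ → ℝ} {σbar : ℝ × ℝ} {r c m t : ℝ} (hr : 0 ≤ r)
    (hrc : r ≤ c) (hl : ContinuousOn lam (square σbar c))
    (hm : ∀ σ ∈ square σbar r, -m ≤ (lam σ - lam σbar) * t) :
    Real.exp (-m) * r ≤ prefactor lam σbar c t := by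
  have hcpt := isCompact_square σbar r
  have hint := integrableOn_exp_eigenvalue (isCompact_square σbar c) hl (lam σbar) t
  have hsub := square_subset σbar hrc
  refine Real.le_sqrt_of_sq_le ?_
  calc (Real.exp (-m) * r) ^ 2 = ∫ _ in square σbar r, Real.exp (-m) ^ 2 := by
        rw [setIntegral_const, volume_real_square σbar hr, smul_eq_mul, mul_pow, mul_comm]
    _ ≤ ∫ σ in square σbar r, Real.exp (2 * (lam σ - lam σbar) * t) := by
        refine setIntegral_mono_on (integrableOn_const hcpt.measure_ne_top) (hint.mono_set hsub)
          hcpt.measurableSet fun σ hσ => ?_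
        rw [← Real.exp_nat_mul, Real.exp_le_exp]
        push_cast
        linarith [hm σ hσ]
    _ ≤ _ := setIntegral_mono_set hint (.of_forall fun σ => (Real.exp_pos _).le) hsub.eventuallyLE

theorem exists_prefactor_ge {lam : ℝ × ℝ → ℝ} {σbar : ℝ × ℝ} {c : ℝ} (hc : 0 < c)
    (hl : ContinuousOn lam (square σbar c)) {l : ℕ} (hl₀ : l ≠ 0)
    (hO : (fun σ => lam σ - lam σbar) =O[𝓝[square σbar c] σbar] (fun σ => ‖σ - σbar‖ ^ l)) :
    ∃ C₁ : ℝ, 0 < C₁ ∧ ∀ t, 0 ≤ t → C₁ / (1 + t) ^ (1 / (l : ℝ)) ≤ prefactor lam σbar c t := by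
  obtain ⟨C, hC₀, hC⟩ := hO.exists_pos
  rw [Asymptotics.isBigOWith_iff, eventually_nhdsWithin_iff, Metric.eventually_nhds_iff] at hC
  obtain ⟨δ₀, hδ₀, hball⟩ := hC
  obtain ⟨δ, hδ, hδδ₀, hδc⟩ : ∃ δ, 0 < δ ∧ δ < δ₀ ∧ δ ≤ c :=
    ⟨min (δ₀ / 2) c, by positivity, (min_le_left _ _).trans_lt (by linarith), min_le_right _ _⟩
  refine ⟨Real.exp (-(C * δ ^ l)) * δ, by positivity, fun t ht => ?_⟩
  -- On the square of side `r` the exponent `(λ(σ) - λ(σ̄)) t` stays above a constant.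
  set r := δ / (1 + t) ^ (1 / (l : ℝ)) with hr
  have hr₀ : 0 < r := by positivity
  have hrδ : r ≤ δ := div_le_self hδ.le (Real.one_le_rpow (by linarith) (by positivity))
  have hrt : r ^ l * t ≤ δ ^ l := by
    rw [hr, div_pow, one_div, Real.rpow_inv_natCast_pow (by linarith) hl₀, div_mul_eq_mul_div]
    exact div_le_of_le_mul₀ (by linarith) (by positivity) (by gcongr; linarith)
  rw [mul_div_assoc, ← hr]
  refine exp_neg_mul_le_prefactor hr₀.le (hrδ.trans hδc) hl fun σ hσ => ?_
  have hσr := norm_sub_le_of_mem_square hσ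
  have hlam : |lam σ - lam σbar| ≤ C * r ^ l := by
    have hσδ : dist σ σbar < δ₀ := by rw [dist_eq_norm]; linarith
    calc _ ≤ C * ‖‖σ - σbar‖ ^ l‖ := hball hσδ (square_subset σbar (hrδ.trans hδc) hσ)
      _ ≤ C * r ^ l := by rw [norm_pow, norm_norm]; gcongr
  calc -(C * δ ^ l) ≤ -(C * r ^ l) * t := by nlinarith
    _ ≤ _ := mul_le_mul_of_nonneg_right (abs_le.1 hlam).1 ht

/-! ### Dissipativity of the linearized operator and uniqueness -/

/-- The Fourier symbol of `1 + (1 + 2εω)∂ₓ² + ∂_y²`, in the frequency normalization of `𝓕`. -/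
def planeSymbol (ε ω : ℝ) (ξ : Plane) : ℝ :=
  1 - (1 + 2 * ε * ω) * (2 * Real.pi * ξ 0) ^ 2 - (2 * Real.pi * ξ 1) ^ 2

theorem hasTemperateGrowth_coord (i : Fin 2) :
    (fun ξ : Plane => ((ξ i : ℝ) : ℂ)).HasTemperateGrowth :=
  (Complex.ofRealCLM.comp (EuclideanSpace.proj (𝕜 := ℝ) i)).hasTemperateGrowth

theorem hasTemperateGrowth_planeSymbol (ε ω : ℝ) :
    (fun ξ : Plane => (planeSymbol ε ω ξ : ℂ)).HasTemperateGrowth := by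
  have h₀ := hasTemperateGrowth_coord 0
  have h₁ := hasTemperateGrowth_coord 1
  simp only [planeSymbol]
  push_cast
  fun_prop

theorem fourier_lineDeriv_lineDeriv (i : Fin 2) (T : 𝓢'(Plane, ℂ)) :
    𝓕 (∂_{(EuclideanSpace.single i 1 : Plane)} (∂_{(EuclideanSpace.single i 1 : Plane)} T)) =
      smulLeftCLM ℂ (fun ξ : Plane => -(2 * Real.pi * (ξ i : ℂ)) ^ 2) (𝓕 T) := by
  have hi := hasTemperateGrowth_coord i
  have hinner (ξ : Plane) : inner ℝ ξ (EuclideanSpace.single i 1 : Plane) = ξ i := by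
    simp [EuclideanSpace.inner_single_right]
  rw [TemperedDistribution.fourier_lineDerivOp_eq, TemperedDistribution.fourier_lineDerivOp_eq]
  simp only [hinner]
  rw [map_smul, smulLeftCLM_smulLeftCLM_apply hi hi, smul_smul, ← smul_apply,
    ← smulLeftCLM_smul (by exact hi.mul hi)]
  congr 2
  funext ξ
  simp only [Pi.smul_apply, Pi.mul_apply, smul_eq_mul]
  linear_combination (4 * (Real.pi : ℂ) ^ 2 * (ξ i : ℂ) ^ 2) * Complex.I_sq

theorem fourier_planeOp (ε ω : ℝ) (T : 𝓢'(Plane, ℂ)) :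
    𝓕 (planeOp ε ω T) = smulLeftCLM ℂ (fun ξ : Plane => (planeSymbol ε ω ξ : ℂ)) (𝓕 T) := by
  let κ : ℂ := ((1 + 2 * ε * ω : ℝ) : ℂ)
  let D (i : Fin 2) (ξ : Plane) : ℂ := -(2 * Real.pi * (ξ i : ℂ)) ^ 2
  have hone : (fun _ : Plane => (1 : ℂ)).HasTemperateGrowth := by fun_prop
  have hD (i : Fin 2) : (D i).HasTemperateGrowth := by
    have := hasTemperateGrowth_coord i
    fun_prop
  have hκD : (κ • D 0).HasTemperateGrowth := by
    have := hD 0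
    change (fun ξ => κ • D 0 ξ).HasTemperateGrowth
    fun_prop
  have hsymbol : (fun ξ : Plane => (planeSymbol ε ω ξ : ℂ)) = (fun _ => 1) + κ • D 0 + D 1 := by
    funext ξ
    simp only [planeSymbol, Pi.add_apply, Pi.smul_apply, smul_eq_mul, D, κ]
    push_cast
    ring
  rw [planeOp, FourierTransform.fourier_add, FourierTransform.fourier_add,
    FourierTransform.fourier_smul, fourier_lineDeriv_lineDeriv, fourier_lineDeriv_lineDeriv,
    hsymbol, smulLeftCLM_add (hone.add hκD) (hD 1), smulLeftCLM_add hone hκD,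
    smulLeftCLM_smul (hD 0)]
  simp only [add_apply, smul_apply, smulLeftCLM_const, one_smul, κ, D]

theorem ae_eq_of_toTemperedDistribution_eq_smulLeftCLM {g : Plane → ℂ} (hg : g.HasTemperateGrowth)
    {v w : L2Plane} (h : (v : 𝓢'(Plane, ℂ)) = smulLeftCLM ℂ g (w : 𝓢'(Plane, ℂ))) :
    ∀ᵐ ξ : Plane, v ξ = g ξ * w ξ := by
  have hw : LocallyIntegrable w (volume : Measure Plane) :=
    (Lp.memLp w).locallyIntegrable one_le_two
  refine ae_eq_of_integral_contDiff_smul_eq ((Lp.memLp v).locallyIntegrable one_le_two) ?_ ?_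
  · rw [← locallyIntegrableOn_univ] at hw ⊢
    exact hw.continuousOn_mul hg.1.continuous.continuousOn isOpen_univ.isLocallyClosed
  · intro φ hφ hφc
    have hsupp : HasCompactSupport (Complex.ofRealCLM ∘ φ) := hφc.comp_left rfl
    have hdiff : ContDiff ℝ ((⊤ : ℕ∞) : WithTop ℕ∞) (Complex.ofRealCLM ∘ φ) := by fun_prop
    have htest := DFunLike.congr_fun h (hsupp.toSchwartzMap hdiff)
    rw [smulLeftCLM_apply_apply, Lp.toTemperedDistribution_apply,
      Lp.toTemperedDistribution_apply] at htest
    simpa [SchwartzMap.smulLeftCLM_apply_apply hg, mul_assoc, mul_left_comm] using htest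

theorem fourier_ae_eq_of_eq_planeOp_planeOp {ε ω : ℝ} {v h : L2Plane}
    (hv : (h : 𝓢'(Plane, ℂ)) = planeOp ε ω (planeOp ε ω (v : 𝓢'(Plane, ℂ)))) :
    ∀ᵐ ξ : Plane, (𝓕 h : L2Plane) ξ = (planeSymbol ε ω ξ : ℂ) ^ 2 * (𝓕 v : L2Plane) ξ := by
  have hs := hasTemperateGrowth_planeSymbol ε ω
  have hF := congrArg (fun T : 𝓢'(Plane, ℂ) => 𝓕 T) hv
  simp only [fourier_planeOp, Lp.fourier_toTemperedDistribution_eq,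
    smulLeftCLM_smulLeftCLM_apply hs hs] at hF
  filter_upwards [ae_eq_of_toTemperedDistribution_eq_smulLeftCLM (by exact hs.mul hs) hF] with ξ hξ
  rw [hξ, Pi.mul_apply, sq]

theorem plane_norm_sq (ξ : Plane) : ‖ξ‖ ^ 2 = ξ 0 ^ 2 + ξ 1 ^ 2 := by
  simp only [EuclideanSpace.norm_sq_eq, Fin.sum_univ_two, Real.norm_eq_abs, sq_abs]

theorem min_mul_norm_sq_le_one_sub_planeSymbol {ε ω : ℝ} (hk : 0 < 1 + 2 * ε * ω) (ξ : Plane) :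
    min (1 + 2 * ε * ω) 1 * ‖ξ‖ ^ 2 ≤ 1 - planeSymbol ε ω ξ := by
  have hpi : 1 ≤ (2 * Real.pi) ^ 2 := by nlinarith [Real.pi_gt_three]
  have h₀ : min (1 + 2 * ε * ω) 1 * ξ 0 ^ 2 ≤ (1 + 2 * ε * ω) * ((2 * Real.pi) ^ 2 * ξ 0 ^ 2) :=
    mul_le_mul (min_le_left _ _) (le_mul_of_one_le_left (sq_nonneg _) hpi) (sq_nonneg _) hk.le
  have h₁ : min (1 + 2 * ε * ω) 1 * ξ 1 ^ 2 ≤ 1 * ((2 * Real.pi) ^ 2 * ξ 1 ^ 2) :=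
    mul_le_mul (min_le_right _ _) (le_mul_of_one_le_left (sq_nonneg _) hpi) (sq_nonneg _)
      zero_le_one
  rw [plane_norm_sq, planeSymbol]
  linarith

theorem exists_weight_le_planeSymbol {ε ω : ℝ} (hk : 0 < 1 + 2 * ε * ω) :
    ∃ C, ∀ ξ : Plane, (1 + ‖ξ‖ ^ 2) ^ 2 ≤ C * (1 + planeSymbol ε ω ξ ^ 2) := by
  have hm := min_mul_norm_sq_le_one_sub_planeSymbol hk
  set κ := min (1 + 2 * ε * ω) 1
  have hκ₀ : 0 < κ := lt_min hk one_pos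
  have hκ₁ : κ ≤ 1 := min_le_right _ _
  refine ⟨8 / κ ^ 2, fun ξ => ?_⟩
  set m := planeSymbol ε ω ξ
  rw [div_mul_eq_mul_div, le_div_iff₀ (pow_pos hκ₀ 2)]
  calc (1 + ‖ξ‖ ^ 2) ^ 2 * κ ^ 2 = (κ * (1 + ‖ξ‖ ^ 2)) ^ 2 := by ring
    _ ≤ (2 + |m|) ^ 2 := by gcongr; linarith [hm ξ, neg_abs_le m]
    _ ≤ 8 * (1 + m ^ 2) := by nlinarith [sq_abs m, sq_nonneg (|m| - 2)]

theorem memSobolev_four_of_eq_planeOp_planeOp {ε ω : ℝ} (hk : 0 < 1 + 2 * ε * ω) {v h : L2Plane}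
    (hv : (h : 𝓢'(Plane, ℂ)) = planeOp ε ω (planeOp ε ω (v : 𝓢'(Plane, ℂ)))) :
    MemSobolev 4 2 (v : 𝓢'(Plane, ℂ)) := by
  obtain ⟨C, hC⟩ := exists_weight_le_planeSymbol hk
  have hw : (fun ξ : Plane => (((1 + ‖ξ‖ ^ 2) ^ ((4 : ℝ) / 2) : ℝ) : ℂ)).HasTemperateGrowth := by
    fun_prop
  have hmem : MemLp (fun ξ : Plane => (((1 + ‖ξ‖ ^ 2) ^ ((4 : ℝ) / 2) : ℝ) : ℂ) *
      (𝓕 v : L2Plane) ξ) 2 volume := by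
    refine ((Lp.memLp (𝓕 v : L2Plane)).norm.add (Lp.memLp (𝓕 h : L2Plane)).norm).of_le_mul (c := C)
      (hw.1.continuous.aestronglyMeasurable.mul (Lp.aestronglyMeasurable _)) ?_
    filter_upwards [fourier_ae_eq_of_eq_planeOp_planeOp hv] with ξ hξ
    have hpow : (1 + ‖ξ‖ ^ 2) ^ ((4 : ℝ) / 2) = (1 + ‖ξ‖ ^ 2) ^ 2 := by
      rw [← Real.rpow_natCast]
      norm_num
    rw [Pi.add_apply, norm_mul, Complex.norm_real, hpow, hξ, norm_mul,
      norm_pow (planeSymbol ε ω ξ : ℂ), Complex.norm_real, Real.norm_of_nonneg (by positivity),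
      Real.norm_of_nonneg (by positivity), Real.norm_eq_abs, sq_abs]
    nlinarith [mul_le_mul_of_nonneg_right (hC ξ) (norm_nonneg ((𝓕 v : L2Plane) ξ))]
  rw [memSobolev_iff_exists_smulLeftCLM_fourier, Lp.fourier_toTemperedDistribution_eq]
  refine ⟨hmem.toLp, ?_⟩
  ext φ
  rw [smulLeftCLM_apply_apply, Lp.toTemperedDistribution_apply, Lp.toTemperedDistribution_apply]
  refine integral_congr_ae ?_
  filter_upwards [hmem.coeFn_toLp] with ξ hξ
  rw [hξ, SchwartzMap.smulLeftCLM_apply_apply hw]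
  simp only [smul_eq_mul]
  ring

theorem re_inner_nonneg_of_eq_planeOp_planeOp {ε ω : ℝ} {v h : L2Plane}
    (hv : (h : 𝓢'(Plane, ℂ)) = planeOp ε ω (planeOp ε ω (v : 𝓢'(Plane, ℂ)))) :
    0 ≤ (inner ℂ v h).re := by
  have hinner : ∫ ξ : Plane, inner ℂ ((𝓕 v : L2Plane) ξ) ((𝓕 h : L2Plane) ξ) =
      ((∫ ξ : Plane, planeSymbol ε ω ξ ^ 2 * ‖(𝓕 v : L2Plane) ξ‖ ^ 2 : ℝ) : ℂ) := by
    rw [← integral_complex_ofReal]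
    refine integral_congr_ae ?_
    filter_upwards [fourier_ae_eq_of_eq_planeOp_planeOp hv] with ξ hξ
    rw [hξ, RCLike.inner_apply, mul_assoc, Complex.mul_conj, Complex.normSq_eq_norm_sq]
    push_cast
    rfl
  rw [← Lp.inner_fourier_eq, L2.inner_def, hinner, Complex.ofReal_re]
  exact integral_nonneg fun ξ => by positivity

theorem toTemperedDistribution_sub (v w : L2Plane) :
    ((v - w : L2Plane) : 𝓢'(Plane, ℂ)) = (v : 𝓢'(Plane, ℂ)) - (w : 𝓢'(Plane, ℂ)) :=
  map_sub (Lp.toTemperedDistributionCLM ℂ (volume : Measure Plane) 2) v w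

theorem planeOp_sub (ε ω : ℝ) (S T : 𝓢'(Plane, ℂ)) :
    planeOp ε ω (S - T) = planeOp ε ω S - planeOp ε ω T := by
  have hsub (m : Plane) (S T : 𝓢'(Plane, ℂ)) : ∂_{m} (S - T) = ∂_{m} S - ∂_{m} T :=
    map_sub (LineDeriv.lineDerivOpCLM ℂ 𝓢'(Plane, ℂ) m) S T
  simp only [planeOp, hsub, smul_sub]
  abel

theorem re_inner_le_of_linearizedOp {ε ω b s M : ℝ} {u : ℝ → ℝ}
    (hM : ∀ x, |potential ε b s u x| ≤ M) {v f : L2Plane} (h : LinearizedOp ε ω b s u v f) :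
    (inner ℂ v f).re ≤ M * ‖v‖ ^ 2 := by
  obtain ⟨-, g, hg, hf⟩ := h
  have hdissipative : 0 ≤ (inner ℂ v (g - f)).re := by
    refine re_inner_nonneg_of_eq_planeOp_planeOp (ε := ε) (ω := ω) ?_
    rw [toTemperedDistribution_sub, hf]
    abel
  have hnorm : ‖g‖ ≤ M * ‖v‖ := by
    refine Lp.norm_le_mul_norm_of_ae_le_mul ?_
    filter_upwards [hg] with p hp
    rw [hp, norm_mul, Complex.norm_real]
    gcongr
    exact hM _
  have hcs : (inner ℂ v g).re ≤ ‖v‖ * ‖g‖ := re_inner_le_norm (𝕜 := ℂ) v g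
  rw [inner_sub_right, Complex.sub_re] at hdissipative
  nlinarith [norm_nonneg v]

theorem LinearizedOp.sub {ε ω b s : ℝ} {u : ℝ → ℝ} {v₁ v₂ f₁ f₂ : L2Plane}
    (h₁ : LinearizedOp ε ω b s u v₁ f₁) (h₂ : LinearizedOp ε ω b s u v₂ f₂) :
    LinearizedOp ε ω b s u (v₁ - v₂) (f₁ - f₂) := by
  obtain ⟨hmem₁, g₁, hg₁, hf₁⟩ := h₁
  obtain ⟨hmem₂, g₂, hg₂, hf₂⟩ := h₂
  refine ⟨by rw [toTemperedDistribution_sub]; exact hmem₁.sub hmem₂, g₁ - g₂, ?_, ?_⟩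
  · filter_upwards [hg₁, hg₂, Lp.coeFn_sub g₁ g₂, Lp.coeFn_sub v₁ v₂] with p hp₁ hp₂ hgp hvp
    rw [hgp, hvp, Pi.sub_apply, Pi.sub_apply, hp₁, hp₂, mul_sub]
  · simp only [toTemperedDistribution_sub, planeOp_sub, hf₁, hf₂]
    abel

section Dissipative

variable {𝕜 E : Type*} [RCLike 𝕜] [NormedAddCommGroup E] [InnerProductSpace 𝕜 E]
  [NormedSpace ℝ E] {d : ℝ → E}

theorem hasDerivAt_norm_sq {d' : E} {t : ℝ} (hd : HasDerivAt d d' t) :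
    HasDerivAt (fun t => ‖d t‖ ^ 2) (2 * RCLike.re (inner 𝕜 (d t) d')) t := by
  have hre := (RCLike.reCLM (K := 𝕜)).hasFDerivAt.comp_hasDerivAt t (hd.inner 𝕜 hd)
  have hfun : (fun t => ‖d t‖ ^ 2) = fun t => RCLike.reCLM (inner 𝕜 (d t) (d t)) := by
    funext τ
    simp
  have hval : 2 * RCLike.re (inner 𝕜 (d t) d') =
      RCLike.reCLM (inner 𝕜 (d t) d' + inner 𝕜 d' (d t)) := by
    rw [RCLike.reCLM_apply, map_add, inner_re_symm d' (d t), two_mul]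
  rw [hfun, hval]
  exact hre

theorem norm_le_exp_mul_norm_of_re_inner_le {M : ℝ} (hc : ContinuousOn d (Set.Ici 0))
    (hd : ∀ t, 0 < t → ∃ d', HasDerivAt d d' t ∧ RCLike.re (inner 𝕜 (d t) d') ≤ M * ‖d t‖ ^ 2)
    {t : ℝ} (ht : 0 ≤ t) : ‖d t‖ ≤ Real.exp (M * t) * ‖d 0‖ := by
  let F : ℝ → ℝ := fun t => Real.exp (-(2 * M) * t) * ‖d t‖ ^ 2
  have hF (t : ℝ) (ht : 0 < t) : ∃ F', HasDerivAt F F' t ∧ F' ≤ 0 := by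
    obtain ⟨d', hd', hle⟩ := hd t ht
    have hexp : HasDerivAt (fun t : ℝ => Real.exp (-(2 * M) * t))
        (Real.exp (-(2 * M) * t) * (-(2 * M))) t := by
      simpa using ((hasDerivAt_id t).const_mul (-(2 * M))).exp
    refine ⟨_, hexp.mul (hasDerivAt_norm_sq (𝕜 := 𝕜) hd'), ?_⟩
    nlinarith [Real.exp_pos (-(2 * M) * t)]
  have hanti : AntitoneOn F (Set.Ici 0) := by
    refine antitoneOn_of_deriv_nonpos (convex_Ici 0) (by fun_prop) (fun t ht => ?_) fun t ht => ?_
    all_goals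
      rw [interior_Ici] at ht
      obtain ⟨F', hF', hle⟩ := hF t ht
    · exact hF'.differentiableAt.differentiableWithinAt
    · rwa [hF'.deriv]
  have hle : Real.exp (-(2 * M) * t) * ‖d t‖ ^ 2 ≤ ‖d 0‖ ^ 2 := by
    simpa [F] using hanti (Set.mem_Ici.2 le_rfl) (Set.mem_Ici.2 ht) ht
  refine (sq_le_sq₀ (norm_nonneg _) (by positivity)).1 ?_
  calc ‖d t‖ ^ 2 = Real.exp (M * t) ^ 2 * (Real.exp (-(2 * M) * t) * ‖d t‖ ^ 2) := by
        rw [← mul_assoc, ← Real.exp_nat_mul, ← Real.exp_add]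
        simp [mul_assoc]
    _ ≤ (Real.exp (M * t) * ‖d 0‖) ^ 2 := by rw [mul_pow]; gcongr

end Dissipative

theorem IsSemigroupOrbit.eq_of_linearizedOp {ε ω b s M : ℝ} {u : ℝ → ℝ}
    (hM : ∀ x, |potential ε b s u x| ≤ M) {w : L2Plane} {V V' : ℝ → L2Plane}
    (hV : IsSemigroupOrbit (LinearizedOp ε ω b s u) w V)
    (hV' : IsSemigroupOrbit (LinearizedOp ε ω b s u) w V') {t : ℝ} (ht : 0 ≤ t) :
    V' t = V t := by
  obtain ⟨h0, hc, hd⟩ := hV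
  obtain ⟨h0', hc', hd'⟩ := hV'
  have hle := norm_le_exp_mul_norm_of_re_inner_le (𝕜 := ℂ) (M := M) (d := fun t => V' t - V t)
    (hc'.sub hc) (fun t ht => by
      obtain ⟨f, hf, hVf⟩ := hd t ht
      obtain ⟨f', hf', hVf'⟩ := hd' t ht
      exact ⟨_, hVf'.sub hVf, re_inner_le_of_linearizedOp hM (hf'.sub hf)⟩) ht
  rw [h0, h0', sub_self, norm_zero, mul_zero] at hle
  exact sub_eq_zero.1 (norm_le_zero_iff.1 hle)

/-! ### Bloch coordinates on the frequency plane -/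

/-- The pair `(j, r)` with `x = j + r`, where `j` is an integer and `r ∈ [a, a + 1)`. -/
def foldReal (a x : ℝ) : ℤ × ℝ := (⌊x - a⌋, a + Int.fract (x - a))

theorem foldReal_add (a x : ℝ) : (foldReal a x).1 + (foldReal a x).2 = x := by
  rw [foldReal, add_left_comm, Int.floor_add_fract, add_sub_cancel]

theorem foldReal_eq_iff {a x : ℝ} {j : ℤ} {r : ℝ} :
    foldReal a x = (j, r) ↔ x = j + r ∧ r ∈ Set.Ico a (a + 1) := by
  constructor
  · intro h
    refine ⟨by simpa only [h] using (foldReal_add a x).symm, ?_⟩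
    have hr : r = a + Int.fract (x - a) := (Prod.ext_iff.1 h).2.symm
    rw [hr]
    exact ⟨le_add_of_nonneg_right (Int.fract_nonneg _), by gcongr; exact Int.fract_lt_one _⟩
  · rintro ⟨rfl, h₁, h₂⟩
    have hfloor : ⌊(j : ℝ) + r - a⌋ = j := Int.floor_eq_iff.2 ⟨by linarith, by linarith⟩
    rw [foldReal, ← Int.self_sub_floor, hfloor]
    ring_nf

theorem foldReal_preimage_prod (a : ℝ) (s : Set ℤ) (t : Set ℝ) :
    foldReal a ⁻¹' (s ×ˢ t) = ⋃ j ∈ s, (fun x => x + -(j : ℝ)) ⁻¹' (t ∩ Set.Ico a (a + 1)) := by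
  ext x
  simp only [Set.mem_preimage, Set.mem_iUnion, exists_prop]
  constructor
  · rintro ⟨hs, ht⟩
    have hx : x + -((foldReal a x).1 : ℝ) = (foldReal a x).2 := by linarith [foldReal_add a x]
    exact ⟨_, hs, by rw [hx]; exact ⟨ht, (foldReal_eq_iff.1 rfl).2⟩⟩
  · rintro ⟨j, hj, ht, hr⟩
    rw [foldReal_eq_iff.2 ⟨(add_add_neg_cancel'_right _ _).symm, hr⟩]
    exact ⟨hj, ht⟩

theorem measurable_foldReal (a : ℝ) : Measurable (foldReal a) :=
  (Int.measurable_floor.comp (by fun_prop)).prodMk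
    ((measurable_fract.comp (by fun_prop)).const_add a)

theorem measurePreserving_foldReal (a : ℝ) :
    MeasurePreserving (foldReal a) volume
      (Measure.count.prod (volume.restrict (Set.Icc a (a + 1)))) := by
  refine ⟨measurable_foldReal a, (Measure.prod_eq fun s t hs ht => ?_).symm⟩
  have hdisj : s.PairwiseDisjoint
      (fun j : ℤ => (fun x => x + -(j : ℝ)) ⁻¹' (t ∩ Set.Ico a (a + 1))) := by
    refine fun i _ j _ hij => Set.disjoint_left.2 fun x hi hj => hij ?_
    have hfold (k : ℤ) (hk : x + -(k : ℝ) ∈ t ∩ Set.Ico a (a + 1)) : (foldReal a x).1 = k := by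
      rw [foldReal_eq_iff.2 ⟨(add_add_neg_cancel'_right _ _).symm, hk.2⟩]
    exact (hfold i hi).symm.trans (hfold j hj)
  rw [Measure.map_apply (measurable_foldReal a) (hs.prod ht), foldReal_preimage_prod,
    measure_biUnion s.to_countable hdisj fun j _ =>
      (measurable_id.add_const _) (ht.inter measurableSet_Ico)]
  simp only [measure_preimage_add_right]
  rw [ENNReal.tsum_const, Measure.count_apply hs, Set.encard, ← restrict_Ico_eq_restrict_Icc,
    Measure.restrict_apply ht]

/-- The Bloch coordinates `(j, σ)` of the frequency `(σ₁ + j, σ₂)`, where `σ₁ ∈ [a, a + 1)`. -/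
def blochCoord (a : ℝ) (η : Plane) : ℤ × (ℝ × ℝ) :=
  ((foldReal a (η 0)).1, ((foldReal a (η 0)).2, η 1))

/-- The strip `[a, a + 1] × ℝ` of Bloch parameters, a period cell in the first one. -/
def strip (a : ℝ) : Set (ℝ × ℝ) := Set.Icc a (a + 1) ×ˢ Set.univ

theorem square_subset_strip (σbar : ℝ × ℝ) {c : ℝ} (hc : c ≤ 1) :
    square σbar c ⊆ strip σbar.1 :=
  Set.prod_mono (Set.Icc_subset_Icc_right (by gcongr)) (Set.subset_univ _)

/-- The image of the Lebesgue measure of the frequency plane in Bloch coordinates. -/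
def blochMeasure (a : ℝ) : Measure (ℤ × (ℝ × ℝ)) :=
  Measure.count.prod (volume.restrict (strip a))

theorem measurePreserving_blochCoord (a : ℝ) :
    MeasurePreserving (blochCoord a) volume (blochMeasure a) := by
  have hfold := (measurePreserving_foldReal a).prod (MeasurePreserving.id (volume : Measure ℝ))
  have hassoc := measurePreserving_prodAssoc (Measure.count : Measure ℤ)
    ((volume : Measure ℝ).restrict (Set.Icc a (a + 1))) (volume : Measure ℝ)
  rw [blochMeasure, strip, Measure.volume_eq_prod, ← Measure.prod_restrict, Measure.restrict_univ]
  exact hassoc.comp (hfold.comp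
    ((volume_preserving_finTwoArrow ℝ).comp (PiLp.volume_preserving_ofLp (Fin 2))))

theorem measurable_blochCoord_smul (a : ℝ) :
    Measurable (fun ξ : Plane => blochCoord a ((2 * Real.pi) • ξ)) :=
  (measurePreserving_blochCoord a).measurable.comp (measurable_const_smul _)

theorem map_blochCoord_smul (a : ℝ) :
    Measure.map (fun ξ : Plane => blochCoord a ((2 * Real.pi) • ξ)) volume =
      ENNReal.ofReal ((2 * Real.pi) ^ 2)⁻¹ • blochMeasure a := by
  have hcomp : (fun ξ : Plane => blochCoord a ((2 * Real.pi) • ξ)) =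
      blochCoord a ∘ ((2 * Real.pi) • ·) := rfl
  rw [hcomp, ← Measure.map_map (measurePreserving_blochCoord a).measurable (by fun_prop),
    Measure.map_addHaar_smul _ Real.two_pi_pos.ne', Measure.map_smul,
    (measurePreserving_blochCoord a).map_eq, finrank_euclideanSpace_fin,
    abs_of_pos (by positivity)]

theorem lintegral_blochCoord_smul (a : ℝ) {F : ℤ × (ℝ × ℝ) → ℝ≥0∞} (hF : Measurable F) :
    ∫⁻ ξ : Plane, F (blochCoord a ((2 * Real.pi) • ξ)) =
      ENNReal.ofReal ((2 * Real.pi) ^ 2)⁻¹ * ∫⁻ σ in strip a, ∑' j, F (j, σ) := by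
  rw [← lintegral_map hF (measurable_blochCoord_smul a), map_blochCoord_smul,
    lintegral_smul_measure, smul_eq_mul, blochMeasure, lintegral_prod_symm _ hF.aemeasurable]
  simp only [lintegral_count]

theorem integral_blochCoord_smul (a : ℝ) {F : ℤ × (ℝ × ℝ) → ℂ}
    (hF : Integrable F (blochMeasure a)) :
    ∫ ξ : Plane, F (blochCoord a ((2 * Real.pi) • ξ)) =
      (((2 * Real.pi) ^ 2)⁻¹ : ℝ) • ∫ σ in strip a, ∑' j, F (j, σ) := by
  have hmeas : AEStronglyMeasurable F
      (Measure.map (fun ξ : Plane => blochCoord a ((2 * Real.pi) • ξ)) volume) := by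
    rw [map_blochCoord_smul]
    exact hF.aestronglyMeasurable.smul_measure _
  rw [← integral_map (measurable_blochCoord_smul a).aemeasurable hmeas, map_blochCoord_smul,
    integral_smul_measure, ENNReal.toReal_ofReal (by positivity), blochMeasure,
    integral_prod_symm _ hF]
  congr 1
  refine integral_congr_ae ?_
  filter_upwards [hF.prod_left_ae] with σ hσ
  simp [integral_countable hσ, Measure.real]

/-! ### The Fourier transform of a superposition of Bloch waves -/

section FourierInv

variable {V : Type*} [NormedAddCommGroup V] [InnerProductSpace ℝ V] [FiniteDimensional ℝ V]
  [MeasurableSpace V] [BorelSpace V]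

theorem continuous_fourierInv_of_integrable {f : V → ℂ} (hf : Integrable f) :
    Continuous (𝓕⁻ f) :=
  VectorFourier.fourierIntegral_continuous (L := -innerₗ V) Real.continuous_fourierChar
    (continuous_inner (𝕜 := ℝ) (E := V)).neg hf

theorem integral_fourierInv_mul_of_integrable {f g : V → ℂ} (hf : Integrable f)
    (hg : Integrable g) : ∫ ξ, 𝓕⁻ f ξ * g ξ = ∫ x, f x * 𝓕⁻ g x := by
  have hflip : (-innerₗ V).flip = -innerₗ V := by
    ext x y
    simp [real_inner_comm]
  have h := VectorFourier.integral_fourierIntegral_smul_eq_flip (L := -innerₗ V)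
    Real.continuous_fourierChar (continuous_inner (𝕜 := ℝ) (E := V)).neg hf hg
  rw [hflip] at h
  simpa using! h

theorem fourierInv_toLp_ae_eq {f : V → ℂ} (hf₁ : Integrable f) (hf₂ : MemLp f 2 volume) :
    (𝓕⁻ hf₂.toLp : Lp ℂ 2 (volume : Measure V)) =ᵐ[volume] 𝓕⁻ f := by
  refine ae_eq_of_integral_contDiff_smul_eq ((Lp.memLp _).locallyIntegrable (by norm_num))
    (continuous_fourierInv_of_integrable hf₁).locallyIntegrable fun φ hφ hφc => ?_
  have hφc' : HasCompactSupport (Complex.ofRealCLM ∘ φ) := hφc.comp_left rfl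
  let Φ : 𝓢(V, ℂ) := hφc'.toSchwartzMap (by fun_prop)
  have hdual := DFunLike.congr_fun (Lp.fourierInv_toTemperedDistribution_eq hf₂.toLp) Φ
  rw [TemperedDistribution.fourierInv_apply, Lp.toTemperedDistribution_apply,
    Lp.toTemperedDistribution_apply] at hdual
  calc ∫ x, φ x • (𝓕⁻ hf₂.toLp : Lp ℂ 2 (volume : Measure V)) x =
          ∫ ξ, (𝓕⁻ Φ) ξ • (hf₂.toLp : Lp ℂ 2 (volume : Measure V)) ξ := by
        simpa [Φ] using hdual.symm
    _ = ∫ ξ, 𝓕⁻ (Φ : V → ℂ) ξ * f ξ := by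
        refine integral_congr_ae ?_
        filter_upwards [hf₂.coeFn_toLp] with ξ hξ
        rw [hξ, smul_eq_mul, SchwartzMap.fourierInv_coe]
    _ = ∫ x, Φ x * 𝓕⁻ f x := integral_fourierInv_mul_of_integrable (SchwartzMap.integrable _) hf₁
    _ = ∫ x, φ x • 𝓕⁻ f x := by simp [Φ]

end FourierInv

/-- The `j`-th Fourier coefficient of `W σ` as a function of `(j, σ)`, extended by zero to
`σ ∉ K`. -/
def blochCoeff (K : Set (ℝ × ℝ)) (W : ℝ × ℝ → ℝ → ℂ) (z : ℤ × (ℝ × ℝ)) : ℂ :=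
  K.indicator (fun σ => torusCoeff (W σ) z.1) z.2

/-- The Fourier transform of `blochSuperposition K W`, expressed in Bloch coordinates. The scaling
`2π` comes from Mathlib's normalization of the Fourier transform. -/
def blochDensity (a : ℝ) (K : Set (ℝ × ℝ)) (W : ℝ × ℝ → ℝ → ℂ) (ξ : Plane) : ℂ :=
  ((2 * Real.pi) ^ 2 : ℝ) • blochCoeff K W (blochCoord a ((2 * Real.pi) • ξ))

section BlochDensity

variable {a : ℝ} {K : Set (ℝ × ℝ)} {W : ℝ × ℝ → ℝ → ℂ}

theorem IsBlochFamilyOn.measurable_blochCoeff (hW : IsBlochFamilyOn K W) (hK : IsCompact K) :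
    Measurable (blochCoeff K W) := by
  classical
  refine measurable_from_prod_countable_right fun j => ?_
  have h := (hW.continuousOn_torusCoeff j).measurable_piecewise (g := 0) continuousOn_const
    hK.measurableSet
  simpa [blochCoeff, Set.piecewise_eq_indicator] using h

theorem IsBlochFamilyOn.integrable_blochCoeff (hW : IsBlochFamilyOn K W) (hK : IsCompact K)
    (a : ℝ) : Integrable (blochCoeff K W) (blochMeasure a) := by
  obtain ⟨D, hD⟩ := hW.exists_norm_torusCoeff_le
  have hj : Integrable (fun j : ℤ => D * (1 + (j : ℝ) ^ 2)⁻¹) Measure.count :=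
    integrable_count_iff.2 (summable_inv_one_add_sq.mul_left D).norm
  have hσ : Integrable (K.indicator (1 : ℝ × ℝ → ℝ)) (volume.restrict (strip a)) :=
    ((integrable_indicator_iff hK.measurableSet).2
      (integrableOn_const hK.measure_lt_top.ne)).restrict
  refine (hj.mul_prod hσ).mono' (hW.measurable_blochCoeff hK).aestronglyMeasurable
    (Eventually.of_forall fun ⟨j, σ⟩ => ?_)
  by_cases h : σ ∈ K
  · simpa [blochCoeff, h] using hD σ h j
  · simp [blochCoeff, h]

theorem IsBlochFamilyOn.exists_norm_blochCoeff_le (hW : IsBlochFamilyOn K W) :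
    ∃ D, ∀ z, ‖blochCoeff K W z‖ ≤ D := by
  obtain ⟨M, hM⟩ := hW.exists_norm_le
  refine ⟨max M 0, fun ⟨j, σ⟩ => ?_⟩
  by_cases h : σ ∈ K
  · simp only [blochCoeff, h, Set.indicator_of_mem]
    exact (norm_torusCoeff_le (hM σ h) j).trans (le_max_left _ _)
  · simp [blochCoeff, h]

theorem IsBlochFamilyOn.memLp_two_blochCoeff (hW : IsBlochFamilyOn K W) (hK : IsCompact K)
    (a : ℝ) : MemLp (blochCoeff K W) 2 (blochMeasure a) := by
  obtain ⟨D, hD⟩ := hW.exists_norm_blochCoeff_le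
  have hi := hW.integrable_blochCoeff hK a
  rw [memLp_two_iff_integrable_sq_norm hi.aestronglyMeasurable]
  simp only [sq]
  exact hi.norm.bdd_mul hi.norm.aestronglyMeasurable
    (Eventually.of_forall fun z => (norm_norm _).trans_le (hD z))

theorem IsBlochFamilyOn.integrable_blochDensity (hW : IsBlochFamilyOn K W) (hK : IsCompact K)
    (a : ℝ) : Integrable (blochDensity a K W) := by
  have h := (hW.integrable_blochCoeff hK a).smul_measure
    (ENNReal.ofReal_ne_top (r := ((2 * Real.pi) ^ 2)⁻¹))
  rw [← map_blochCoord_smul] at h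
  exact (h.comp_measurable (measurable_blochCoord_smul a)).smul ((2 * Real.pi) ^ 2)

theorem IsBlochFamilyOn.memLp_two_blochDensity (hW : IsBlochFamilyOn K W) (hK : IsCompact K)
    (a : ℝ) : MemLp (blochDensity a K W) 2 volume := by
  have h := (hW.memLp_two_blochCoeff hK a).smul_measure
    (ENNReal.ofReal_ne_top (r := ((2 * Real.pi) ^ 2)⁻¹))
  rw [← map_blochCoord_smul] at h
  exact (h.comp_of_map (measurable_blochCoord_smul a).aemeasurable).const_smul ((2 * Real.pi) ^ 2)

theorem inner_eq_blochCoord (a : ℝ) (ξ p : Plane) :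
    2 * Real.pi * inner ℝ ξ p =
      ((blochCoord a ((2 * Real.pi) • ξ)).1 + (blochCoord a ((2 * Real.pi) • ξ)).2.1) * p 0 +
        (blochCoord a ((2 * Real.pi) • ξ)).2.2 * p 1 := by
  simp only [blochCoord, foldReal_add, PiLp.inner_apply, Fin.sum_univ_two, RCLike.inner_apply,
    conj_trivial, PiLp.smul_apply, smul_eq_mul]
  ring

theorem IsBlochFamilyOn.fourierInv_blochDensity (hW : IsBlochFamilyOn K W) (hK : IsCompact K)
    (hKa : K ⊆ strip a) : 𝓕⁻ (blochDensity a K W) = blochSuperposition K W := by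
  ext p
  let wave (z : ℤ × (ℝ × ℝ)) : ℂ :=
    Complex.exp (((z.1 + z.2.1) * p 0 + z.2.2 * p 1 : ℝ) * Complex.I)
  have hwave : Measurable wave := by
    refine measurable_from_prod_countable_right fun j => ?_
    fun_prop
  have hint : Integrable (fun z => wave z * blochCoeff K W z) (blochMeasure a) :=
    (hW.integrable_blochCoeff hK a).bdd_mul (c := 1) hwave.aestronglyMeasurable
      (Eventually.of_forall fun z => (Complex.norm_exp_ofReal_mul_I _).le)
  have hsum (σ : ℝ × ℝ) : ∑' j, wave (j, σ) * blochCoeff K W (j, σ) =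
      K.indicator (fun σ => Complex.exp (Complex.I * (σ.1 * p 0 + σ.2 * p 1)) * W σ (p 0)) σ := by
    by_cases hσ : σ ∈ K
    · simp only [hσ, Set.indicator_of_mem, blochCoeff]
      rw [← (hW.hasSum hσ (p 0)).tsum_eq, ← tsum_mul_left]
      refine tsum_congr fun j => ?_
      rw [mul_left_comm, ← Complex.exp_add, mul_comm]
      simp only [wave]
      congr 2
      push_cast
      ring
    · simp [blochCoeff, hσ]
  calc 𝓕⁻ (blochDensity a K W) p
      = ∫ ξ : Plane, ((2 * Real.pi) ^ 2 : ℝ) • (wave (blochCoord a ((2 * Real.pi) • ξ)) *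
          blochCoeff K W (blochCoord a ((2 * Real.pi) • ξ))) := by
        simp only [Real.fourierInv_eq', inner_eq_blochCoord a, blochDensity, wave, smul_eq_mul,
          mul_smul_comm]
    _ = ∫ σ in strip a, ∑' j, wave (j, σ) * blochCoeff K W (j, σ) := by
        rw [integral_smul, integral_blochCoord_smul a hint, smul_smul,
          mul_inv_cancel₀ (by positivity), one_smul]
    _ = blochSuperposition K W p := by
        simp only [hsum]
        rw [integral_indicator hK.measurableSet, Measure.restrict_restrict hK.measurableSet,
          Set.inter_eq_left.2 hKa, blochSuperposition]

theorem IsBlochFamilyOn.fourierInv_toLp_blochDensity_ae_eq (hW : IsBlochFamilyOn K W)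
    (hK : IsCompact K) (hKa : K ⊆ strip a) :
    (𝓕⁻ (hW.memLp_two_blochDensity hK a).toLp : L2Plane) =ᵐ[volume] blochSuperposition K W := by
  rw [← hW.fourierInv_blochDensity hK hKa]
  exact fourierInv_toLp_ae_eq (hW.integrable_blochDensity hK a) _

theorem IsBlochFamilyOn.memLp_two_blochSuperposition (hW : IsBlochFamilyOn K W)
    (hK : IsCompact K) (hKa : K ⊆ strip a) : MemLp (blochSuperposition K W) 2 volume :=
  (Lp.memLp _).ae_eq (hW.fourierInv_toLp_blochDensity_ae_eq hK hKa)

theorem IsBlochFamilyOn.fourier_toLp_blochSuperposition (hW : IsBlochFamilyOn K W)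
    (hK : IsCompact K) (hKa : K ⊆ strip a) (hU : MemLp (blochSuperposition K W) 2 volume) :
    𝓕 (hU.toLp : L2Plane) = (hW.memLp_two_blochDensity hK a).toLp := by
  have h : hU.toLp = 𝓕⁻ (hW.memLp_two_blochDensity hK a).toLp :=
    Lp.ext (hU.coeFn_toLp.trans (hW.fourierInv_toLp_blochDensity_ae_eq hK hKa).symm)
  rw [h, FourierTransform.fourier_fourierInv_eq]

end BlochDensity

/-! ### The linearized operator on superpositions of Bloch waves -/

/-- The Bloch wave `e^{i(σ₁x + σ₂y)} w(x)`. -/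
def blochWave (σ : ℝ × ℝ) (w : ℝ → ℂ) (p : Plane) : ℂ :=
  Complex.exp (Complex.I * (σ.1 * p 0 + σ.2 * p 1)) * w (p 0)

theorem norm_blochWave (σ : ℝ × ℝ) (w : ℝ → ℂ) (p : Plane) : ‖blochWave σ w p‖ = ‖w (p 0)‖ := by
  rw [blochWave, norm_mul, Complex.norm_exp]
  simp

theorem integrable_blochWave_mul (σ : ℝ × ℝ) {w : ℝ → ℂ} (hw : Continuous w)
    (hp : Function.Periodic w (2 * Real.pi)) (φ : 𝓢(Plane, ℂ)) :
    Integrable (fun p => blochWave σ w p * φ p) := by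
  obtain ⟨C, hC⟩ := exists_norm_le_of_periodic Real.two_pi_pos.ne' hw hp
  have hcont : Continuous (blochWave σ w) := by
    unfold blochWave
    fun_prop
  exact φ.integrable.bdd_mul hcont.aestronglyMeasurable
    (Eventually.of_forall fun p => (norm_blochWave σ w p).trans_le (hC _))

/-- The operator induced on profiles `w` by the derivative of the Bloch wave
`e^{i(σ₁x + σ₂y)} w(x)` in the direction `m`. -/
def blochLineDeriv (σ : ℝ × ℝ) (m : Plane) (w : ℝ → ℂ) (x : ℝ) : ℂ :=
  m 0 * blochDeriv σ w x + Complex.I * (σ.2 * m 1) * w x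

theorem contDiff_blochLineDeriv {n : ℕ} {w : ℝ → ℂ} (hw : ContDiff ℝ (n + 1 : ℕ) w) (σ : ℝ × ℝ)
    (m : Plane) : ContDiff ℝ n (blochLineDeriv σ m w) :=
  (contDiff_const.mul (contDiff_blochDeriv hw σ)).add
    (contDiff_const.mul (hw.of_le (mod_cast n.le_succ)))

theorem periodic_blochLineDeriv {w : ℝ → ℂ} {T : ℝ} (hw : Function.Periodic w T) (σ : ℝ × ℝ)
    (m : Plane) : Function.Periodic (blochLineDeriv σ m w) T := fun x => by
  simp only [blochLineDeriv, periodic_blochDeriv hw σ x, hw x]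

theorem hasLineDerivAt_blochWave (σ : ℝ × ℝ) {w : ℝ → ℂ} (hw : Differentiable ℝ w) (m p : Plane) :
    HasLineDerivAt ℝ (blochWave σ w) (blochWave σ (blochLineDeriv σ m w) p) p m := by
  have hcoord (i : Fin 2) : HasDerivAt (fun t : ℝ => (p + t • m) i) (m i) 0 := by
    simpa using ((hasDerivAt_id (0 : ℝ)).mul_const (m i)).const_add (p i)
  have hphase := (((hcoord 0).ofReal_comp.const_mul (σ.1 : ℂ)).add
    ((hcoord 1).ofReal_comp.const_mul (σ.2 : ℂ))).const_mul Complex.I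
  have hprofile : HasDerivAt (fun t : ℝ => w ((p + t • m) 0)) (m 0 • deriv w ((p + (0 : ℝ) • m) 0))
      0 := (hw _).hasDerivAt.scomp 0 (hcoord 0)
  rw [HasLineDerivAt]
  refine (hphase.cexp.mul hprofile).congr_deriv ?_
  simp only [blochWave, blochLineDeriv, blochDeriv, zero_smul, add_zero, Pi.add_apply,
    Complex.real_smul]
  ring

theorem integral_blochWave_mul_lineDeriv (σ : ℝ × ℝ) {w : ℝ → ℂ} (hw : ContDiff ℝ 1 w)
    (hp : Function.Periodic w (2 * Real.pi)) (m : Plane) (φ : 𝓢(Plane, ℂ)) :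
    ∫ p, blochWave σ w p * (∂_{m} φ) p = -∫ p, blochWave σ (blochLineDeriv σ m w) p * φ p := by
  refine integral_bilinear_hasLineDerivAt_right_eq_neg_left_of_integrable
    (B := ContinuousLinearMap.mul ℝ ℂ)
    (integrable_blochWave_mul σ (contDiff_blochLineDeriv (n := 0) (mod_cast hw) σ m).continuous
      (periodic_blochLineDeriv hp σ m) φ)
    (integrable_blochWave_mul σ hw.continuous hp _)
    (integrable_blochWave_mul σ hw.continuous hp _)
    (fun p _ => hasLineDerivAt_blochWave σ (hw.differentiable one_ne_zero) m p) fun p _ => ?_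
  rw [SchwartzMap.lineDerivOp_apply]
  exact φ.differentiableAt.lineDifferentiableAt.hasLineDerivAt

theorem integral_blochWave_mul_lineDeriv_lineDeriv (σ : ℝ × ℝ) {w : ℝ → ℂ} (hw : ContDiff ℝ 2 w)
    (hp : Function.Periodic w (2 * Real.pi)) (m : Plane) (φ : 𝓢(Plane, ℂ)) :
    ∫ p, blochWave σ w p * (∂_{m} (∂_{m} φ)) p =
      ∫ p, blochWave σ (blochLineDeriv σ m (blochLineDeriv σ m w)) p * φ p := by
  rw [integral_blochWave_mul_lineDeriv σ (hw.of_le one_le_two) hp,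
    integral_blochWave_mul_lineDeriv σ (contDiff_blochLineDeriv (n := 1) (mod_cast hw) σ m)
      (periodic_blochLineDeriv hp σ m), neg_neg]

theorem blochInner_eq_blochLineDeriv (ε ω : ℝ) (σ : ℝ × ℝ) (w : ℝ → ℂ) (x : ℝ) :
    blochInner ε ω σ w x = w x +
      ((1 + 2 * ε * ω : ℝ) : ℂ) * blochLineDeriv σ (EuclideanSpace.single 0 1)
        (blochLineDeriv σ (EuclideanSpace.single 0 1) w) x +
      blochLineDeriv σ (EuclideanSpace.single 1 1)
        (blochLineDeriv σ (EuclideanSpace.single 1 1) w) x := by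
  have hx (f : ℝ → ℂ) : blochLineDeriv σ (EuclideanSpace.single 0 1) f = blochDeriv σ f := by
    ext y
    simp [blochLineDeriv]
  have hy (f : ℝ → ℂ) (y : ℝ) :
      blochLineDeriv σ (EuclideanSpace.single 1 1) f y = Complex.I * σ.2 * f y := by
    simp [blochLineDeriv]
  rw [hx, hx, hy, hy, blochInner]
  linear_combination -(σ.2 : ℂ) ^ 2 * w x * Complex.I_sq

/-- The operator `1 + (1 + 2εω)∂ₓ² + ∂_y²` on Schwartz functions, of which `planeOp` is the
transpose. -/
def planeOpTest (ε ω : ℝ) (φ : 𝓢(Plane, ℂ)) : 𝓢(Plane, ℂ) :=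
  φ + ((1 + 2 * ε * ω : ℝ) : ℂ) •
      ∂_{(EuclideanSpace.single 0 1 : Plane)} (∂_{(EuclideanSpace.single 0 1 : Plane)} φ) +
    ∂_{(EuclideanSpace.single 1 1 : Plane)} (∂_{(EuclideanSpace.single 1 1 : Plane)} φ)

theorem planeOp_apply (ε ω : ℝ) (T : 𝓢'(Plane, ℂ)) (φ : 𝓢(Plane, ℂ)) :
    planeOp ε ω T φ = T (planeOpTest ε ω φ) := by
  have hneg (m : Plane) (ψ : 𝓢(Plane, ℂ)) : ∂_{m} (-ψ) = -∂_{m} ψ :=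
    map_neg (LineDeriv.lineDerivOpCLM ℂ 𝓢(Plane, ℂ) m) ψ
  have hsecond (m : Plane) : (∂_{m} (∂_{m} T)) φ = T (∂_{m} (∂_{m} φ)) := by
    rw [lineDerivOp_apply_apply, lineDerivOp_apply_apply, hneg, neg_neg]
  rw [planeOp, planeOpTest, map_add, map_add, map_smul, ← hsecond, ← hsecond]
  rfl

theorem integral_blochWave_mul_planeOpTest (ε ω : ℝ) (σ : ℝ × ℝ) {w : ℝ → ℂ} (hw : ContDiff ℝ 2 w)
    (hp : Function.Periodic w (2 * Real.pi)) (φ : 𝓢(Plane, ℂ)) :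
    ∫ p, blochWave σ w p * planeOpTest ε ω φ p =
      ∫ p, blochWave σ (blochInner ε ω σ w) p * φ p := by
  have hi (ψ : 𝓢(Plane, ℂ)) := integrable_blochWave_mul σ hw.continuous hp ψ
  have hd (m : Plane) : Integrable fun p =>
      blochWave σ (blochLineDeriv σ m (blochLineDeriv σ m w)) p * φ p :=
    integrable_blochWave_mul σ
      (contDiff_blochLineDeriv (n := 0)
        (contDiff_blochLineDeriv (n := 1) (mod_cast hw) σ m) σ m).continuous
      (periodic_blochLineDeriv (periodic_blochLineDeriv hp σ m) σ m) φ
  have htest (p : Plane) : blochWave σ w p * planeOpTest ε ω φ p =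
      blochWave σ w p * φ p + ((1 + 2 * ε * ω : ℝ) : ℂ) * (blochWave σ w p *
          (∂_{(EuclideanSpace.single 0 1 : Plane)} (∂_{(EuclideanSpace.single 0 1 : Plane)} φ)) p) +
        blochWave σ w p * (∂_{(EuclideanSpace.single 1 1 : Plane)}
          (∂_{(EuclideanSpace.single 1 1 : Plane)} φ)) p := by
    simp only [planeOpTest, add_apply, smul_apply, smul_eq_mul]
    ring
  have hinner (p : Plane) : blochWave σ (blochInner ε ω σ w) p * φ p =
      blochWave σ w p * φ p + ((1 + 2 * ε * ω : ℝ) : ℂ) *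
          (blochWave σ (blochLineDeriv σ (EuclideanSpace.single 0 1)
            (blochLineDeriv σ (EuclideanSpace.single 0 1) w)) p * φ p) +
        blochWave σ (blochLineDeriv σ (EuclideanSpace.single 1 1)
          (blochLineDeriv σ (EuclideanSpace.single 1 1) w)) p * φ p := by
    simp only [blochWave, blochInner_eq_blochLineDeriv]
    ring
  simp only [htest, hinner]
  rw [integral_add ((hi _).fun_add ((hi _).const_mul _)) (hi _),
    integral_add (hi _) ((hi _).const_mul _),
    integral_add ((hi _).fun_add ((hd _).const_mul _)) (hd _),
    integral_add (hi _) ((hd _).const_mul _), integral_const_mul, integral_const_mul,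
    integral_blochWave_mul_lineDeriv_lineDeriv σ hw hp,
    integral_blochWave_mul_lineDeriv_lineDeriv σ hw hp]

theorem integral_blochWave_mul_of_eigenfunction {ε ω b s μ : ℝ} {u : ℝ → ℝ}
    (hu : Continuous u) (hup : Function.Periodic u (2 * Real.pi)) {σ : ℝ × ℝ} {w : ℝ → ℂ}
    (hw : IsBlochEigenfunction ε ω b s u σ μ w) (φ : 𝓢(Plane, ℂ)) :
    ∫ p, blochWave σ (fun x => μ * w x) p * φ p =
      -(∫ p, blochWave σ w p * planeOpTest ε ω (planeOpTest ε ω φ) p) +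
        ∫ p, blochWave σ (fun x => potential ε b s u x * w x) p * φ p := by
  obtain ⟨hd, hp, -, heig⟩ := hw
  have hd₂ : ContDiff ℝ 2 (blochInner ε ω σ w) := contDiff_blochInner (n := 2) (mod_cast hd) ε ω σ
  have hp₂ := periodic_blochInner hp ε ω σ
  have hinner := integrable_blochWave_mul σ
    (contDiff_blochInner (n := 0) (mod_cast hd₂) ε ω σ).continuous
    (periodic_blochInner hp₂ ε ω σ) φ
  have hpot := integrable_blochWave_mul σ (w := fun x => (potential ε b s u x : ℂ) * w x)
    ((Complex.continuous_ofReal.comp (continuous_potential hu ε b s)).mul hd.continuous)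
    (fun x => by simp only [potential, hup x, hp x]) φ
  rw [integral_blochWave_mul_planeOpTest ε ω σ (hd.of_le (by norm_num)) hp,
    integral_blochWave_mul_planeOpTest ε ω σ hd₂ hp₂, ← integral_neg,
    ← integral_add hinner.fun_neg hpot]
  refine integral_congr_ae (Eventually.of_forall fun p => ?_)
  simp only [blochWave, ← heig, blochOp]
  ring

section Superposition

variable {K : Set (ℝ × ℝ)} {F : ℝ × ℝ → ℝ → ℂ} {C : ℝ}

theorem integrable_prod_blochWave_mul (hK : IsCompact K)
    (hF : ContinuousOn (fun z : (ℝ × ℝ) × ℝ => F z.1 z.2) (K ×ˢ Set.univ))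
    (hC : ∀ σ ∈ K, ∀ x, ‖F σ x‖ ≤ C) (φ : 𝓢(Plane, ℂ)) :
    Integrable (fun z : (ℝ × ℝ) × Plane => blochWave z.1 (F z.1) z.2 * φ z.2)
      ((volume.restrict K).prod volume) := by
  have hprofile : ContinuousOn (fun z : (ℝ × ℝ) × Plane => F z.1 (z.2 0)) (K ×ˢ Set.univ) :=
    hF.comp (f := fun z : (ℝ × ℝ) × Plane => (z.1, z.2 0)) (by fun_prop)
      fun z hz => ⟨hz.1, Set.mem_univ _⟩
  have hcont : ContinuousOn (fun z : (ℝ × ℝ) × Plane => blochWave z.1 (F z.1) z.2 * φ z.2)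
      (K ×ˢ Set.univ) :=
    (ContinuousOn.mul (by fun_prop) hprofile).mul (φ.continuous.comp continuous_snd).continuousOn
  have hset : MeasurableSet (K ×ˢ (Set.univ : Set Plane)) := hK.measurableSet.prod .univ
  have hprod : ((volume : Measure (ℝ × ℝ)).restrict K).prod (volume : Measure Plane) =
      (volume.prod volume).restrict (K ×ˢ Set.univ) := by
    rw [← Measure.prod_restrict, Measure.restrict_univ]
  have hconst : IntegrableOn (fun _ => C) K := integrableOn_const hK.measure_lt_top.ne
  have hdom : Integrable (fun z : (ℝ × ℝ) × Plane => C * ‖φ z.2‖)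
      ((volume.restrict K).prod volume) := hconst.mul_prod φ.integrable.norm
  rw [hprod] at hdom ⊢
  refine hdom.mono' (hcont.aestronglyMeasurable hset) ((ae_restrict_iff' hset).2
    (Eventually.of_forall fun z hz => ?_))
  rw [norm_mul, norm_blochWave]
  gcongr
  exact hC z.1 hz.1 _

theorem toTemperedDistribution_blochSuperposition_apply (hK : IsCompact K)
    (hF : ContinuousOn (fun z : (ℝ × ℝ) × ℝ => F z.1 z.2) (K ×ˢ Set.univ))
    (hC : ∀ σ ∈ K, ∀ x, ‖F σ x‖ ≤ C) (hU : MemLp (blochSuperposition K F) 2 volume)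
    (φ : 𝓢(Plane, ℂ)) :
    ((hU.toLp : L2Plane) : 𝓢'(Plane, ℂ)) φ = ∫ σ in K, ∫ p, blochWave σ (F σ) p * φ p := by
  rw [Lp.toTemperedDistribution_apply,
    integral_integral_swap (integrable_prod_blochWave_mul hK hF hC φ)]
  refine integral_congr_ae ?_
  filter_upwards [hU.coeFn_toLp] with p hp
  rw [hp, smul_eq_mul, mul_comm, integral_mul_const]
  rfl

theorem blochSuperposition_mul_profile (K : Set (ℝ × ℝ)) (q : ℝ → ℂ) (F : ℝ × ℝ → ℝ → ℂ)
    (p : Plane) :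
    blochSuperposition K (fun σ x => q x * F σ x) p = q (p 0) * blochSuperposition K F p := by
  simp only [blochSuperposition, mul_left_comm _ (q (p 0)), integral_const_mul]

theorem memLp_two_blochSuperposition_mul_profile {q : ℝ → ℂ} (hq : Continuous q) {M : ℝ}
    (hM : ∀ x, ‖q x‖ ≤ M) (hU : MemLp (blochSuperposition K F) 2 volume) :
    MemLp (blochSuperposition K fun σ x => q x * F σ x) 2 volume := by
  simp only [funext (blochSuperposition_mul_profile K q F)]
  exact hU.of_le_mul (c := M) (Continuous.aestronglyMeasurable (by fun_prop) |>.mul hU.1)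
    (.of_forall fun p => norm_mul_le_of_le (hM _) le_rfl)

theorem linearizedOp_blochSuperposition {ε ω b s : ℝ} (hk : 0 < 1 + 2 * ε * ω) {u : ℝ → ℝ}
    (hu : Continuous u) (hup : Function.Periodic u (2 * Real.pi)) {lam : ℝ × ℝ → ℝ}
    {W : ℝ × ℝ → ℝ → ℂ} (hE : ∀ σ ∈ K, IsBlochEigenfunction ε ω b s u σ (lam σ) (W σ))
    (hK : IsCompact K) (hW : IsBlochFamilyOn K W)
    (hlW : IsBlochFamilyOn K (fun σ x => lam σ * W σ x))
    (hU : MemLp (blochSuperposition K W) 2 volume)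
    (hlU : MemLp (blochSuperposition K (fun σ x => lam σ * W σ x)) 2 volume) :
    LinearizedOp ε ω b s u hU.toLp hlU.toLp := by
  set q : ℝ → ℂ := fun x => (potential ε b s u x : ℂ)
  have hqc : Continuous q := Complex.continuous_ofReal.comp (continuous_potential hu ε b s)
  obtain ⟨M, hpot⟩ := exists_abs_potential_le hu hup ε b s
  have hM (x : ℝ) : ‖q x‖ ≤ M := (Complex.norm_real _).trans_le (hpot x)
  obtain ⟨B, hB⟩ := hW.exists_norm_le
  obtain ⟨B', hB'⟩ := hlW.exists_norm_le
  have hqW : ContinuousOn (fun z : (ℝ × ℝ) × ℝ => q z.2 * W z.1 z.2) (K ×ˢ Set.univ) :=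
    (hqc.comp continuous_snd).continuousOn.mul hW.continuousOn_uncurry
  have hqB : ∀ σ ∈ K, ∀ x, ‖q x * W σ x‖ ≤ M * B := fun σ hσ x =>
    norm_mul_le_of_le (hM x) (hB σ hσ x)
  have hqU := memLp_two_blochSuperposition_mul_profile hqc hM hU
  have heq : (hlU.toLp : 𝓢'(Plane, ℂ)) =
      -planeOp ε ω (planeOp ε ω (hU.toLp : 𝓢'(Plane, ℂ))) + (hqU.toLp : 𝓢'(Plane, ℂ)) := by
    ext φ
    change _ = -planeOp ε ω (planeOp ε ω (hU.toLp : 𝓢'(Plane, ℂ))) φ + (hqU.toLp : 𝓢'(Plane, ℂ)) φ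
    rw [planeOp_apply, planeOp_apply,
      toTemperedDistribution_blochSuperposition_apply hK hlW.continuousOn_uncurry hB' hlU,
      toTemperedDistribution_blochSuperposition_apply hK hW.continuousOn_uncurry hB hU,
      toTemperedDistribution_blochSuperposition_apply hK hqW hqB hqU, ← integral_neg,
      ← integral_add
        (integrable_prod_blochWave_mul hK hW.continuousOn_uncurry hB _).integral_prod_left.fun_neg
        (integrable_prod_blochWave_mul hK hqW hqB φ).integral_prod_left]
    exact setIntegral_congr_fun hK.measurableSet fun σ hσ =>
      integral_blochWave_mul_of_eigenfunction hu hup (hE σ hσ) φ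
  refine ⟨memSobolev_four_of_eq_planeOp_planeOp hk (h := hqU.toLp - hlU.toLp) ?_, hqU.toLp, ?_, heq⟩
  · rw [toTemperedDistribution_sub, heq]
    abel
  · filter_upwards [hqU.coeFn_toLp, hU.coeFn_toLp] with p hqp hp
    rw [hqp, hp, blochSuperposition_mul_profile]

end Superposition

/-! ### Evolution of a superposition -/

/-- The family `e^{λ(σ)t} W(·, σ)`, whose superposition is the solution at time `t`. -/
def evolvedFamily (lam : ℝ × ℝ → ℝ) (W : ℝ × ℝ → ℝ → ℂ) (t : ℝ) (σ : ℝ × ℝ) (x : ℝ) : ℂ :=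
  (Real.exp (lam σ * t) : ℂ) * W σ x

theorem evolvedFamily_zero (lam : ℝ × ℝ → ℝ) (W : ℝ × ℝ → ℝ → ℂ) :
    evolvedFamily lam W 0 = W := by
  ext σ x
  simp [evolvedFamily]

theorem IsBlochEigenfunction.const_mul {ε ω b s μ : ℝ} {u : ℝ → ℝ} {σ : ℝ × ℝ} {w : ℝ → ℂ}
    (hw : IsBlochEigenfunction ε ω b s u σ μ w) {c : ℂ} (hc : c ≠ 0) :
    IsBlochEigenfunction ε ω b s u σ μ (fun x => c * w x) := by
  obtain ⟨hd, hp, hne, heig⟩ := hw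
  have hderiv (f : ℝ → ℂ) : blochDeriv σ (fun x => c * f x) = fun x => c * blochDeriv σ f x := by
    ext x
    rw [blochDeriv, blochDeriv, deriv_const_mul_field]
    ring
  have hinner (f : ℝ → ℂ) :
      blochInner ε ω σ (fun x => c * f x) = fun x => c * blochInner ε ω σ f x := by
    ext x
    rw [blochInner, blochInner, hderiv, hderiv]
    ring
  refine ⟨contDiff_const.mul hd, fun x => congrArg (c * ·) (hp x), fun h => hne ?_, fun x => ?_⟩
  · ext x
    simpa [hc] using congrFun h x
  · rw [mul_left_comm, ← heig x, blochOp, blochOp, hinner, hinner]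
    ring

theorem hasDerivAt_toLp_of_norm_le {α E : Type*} [MeasurableSpace α] {μ : Measure α}
    [NormedAddCommGroup E] [NormedSpace ℝ E] {p : ℝ≥0∞} [Fact (1 ≤ p)] {f : ℝ → α → E} {g : α → E}
    (hf : ∀ t, MemLp (f t) p μ) (hg : MemLp g p μ) {t C : ℝ}
    (hle : ∀ᶠ h in 𝓝 (0 : ℝ), ∀ x, ‖f (t + h) x - f t x - h • g x‖ ≤ C * h ^ 2 * ‖f t x‖) :
    HasDerivAt (fun r => (hf r).toLp) hg.toLp t := by
  rw [hasDerivAt_iff_isLittleO_nhds_zero]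
  refine Asymptotics.IsBigO.trans_isLittleO ?_ (Asymptotics.isLittleO_pow_id one_lt_two)
  refine Asymptotics.IsBigO.of_bound (C * ‖(hf t).toLp‖) ?_
  filter_upwards [hle] with h hh
  rw [← MemLp.toLp_sub, ← MemLp.toLp_const_smul, ← MemLp.toLp_sub,
    Real.norm_of_nonneg (sq_nonneg h), mul_right_comm]
  refine Lp.norm_le_mul_norm_of_ae_le_mul ?_
  filter_upwards [(((hf (t + h)).sub (hf t)).sub (hg.const_smul h)).coeFn_toLp, (hf t).coeFn_toLp]
    with x hx hfx
  rw [hx, hfx]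
  exact hh x

theorem abs_exp_mul_add_sub_le {l L t h : ℝ} (hl : |l| ≤ L) (hh : L * |h| ≤ 1) :
    |Real.exp (l * (t + h)) - Real.exp (l * t) - h * (l * Real.exp (l * t))| ≤
      L ^ 2 * h ^ 2 * Real.exp (l * t) := by
  have hlh : |l * h| ≤ L * |h| := by
    rw [abs_mul]
    gcongr
  have hfactor : Real.exp (l * (t + h)) - Real.exp (l * t) - h * (l * Real.exp (l * t)) =
      (Real.exp (l * h) - 1 - l * h) * Real.exp (l * t) := by
    rw [mul_add, Real.exp_add]
    ring
  calc _ = |Real.exp (l * h) - 1 - l * h| * Real.exp (l * t) := by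
        rw [hfactor, abs_mul, abs_of_pos (Real.exp_pos _)]
    _ ≤ (l * h) ^ 2 * Real.exp (l * t) := by
        gcongr
        exact Real.abs_exp_sub_one_sub_id_le (hlh.trans hh)
    _ ≤ _ := by
        rw [← sq_abs (l * h), ← sq_abs h, ← mul_pow]
        gcongr

section Evolution

variable {a : ℝ} {K : Set (ℝ × ℝ)} {lam : ℝ × ℝ → ℝ} {W : ℝ × ℝ → ℝ → ℂ}

theorem IsBlochFamilyOn.exp_mul (hW : IsBlochFamilyOn K W) (hK : IsCompact K)
    (hl : ContinuousOn lam K) (t : ℝ) : IsBlochFamilyOn K (evolvedFamily lam W t) :=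
  hW.mul hK (Complex.continuous_ofReal.comp_continuousOn (by fun_prop))

theorem IsBlochFamilyOn.eigenvalue_mul (hW : IsBlochFamilyOn K W) (hK : IsCompact K)
    (hl : ContinuousOn lam K) : IsBlochFamilyOn K (fun σ x => lam σ * W σ x) :=
  hW.mul hK (Complex.continuous_ofReal.comp_continuousOn hl)

theorem blochDensity_mul (a : ℝ) (K : Set (ℝ × ℝ)) (A : ℝ × ℝ → ℂ) (W : ℝ × ℝ → ℝ → ℂ)
    (ξ : Plane) :
    blochDensity a K (fun σ x => A σ * W σ x) ξ =
      A (blochCoord a ((2 * Real.pi) • ξ)).2 * blochDensity a K W ξ := by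
  simp only [blochDensity, blochCoeff, torusCoeff_const_mul, Set.indicator_mul_right,
    mul_smul_comm]

theorem blochDensity_eq_zero {ξ : Plane} (hξ : (blochCoord a ((2 * Real.pi) • ξ)).2 ∉ K) :
    blochDensity a K W ξ = 0 := by
  rw [blochDensity, blochCoeff, Set.indicator_of_notMem hξ, smul_zero]

theorem norm_blochDensity_evolvedFamily_sub_le {L t h : ℝ} (hL : ∀ σ ∈ K, |lam σ| ≤ L)
    (hh : L * |h| ≤ 1) (ξ : Plane) :
    ‖blochDensity a K (evolvedFamily lam W (t + h)) ξ - blochDensity a K (evolvedFamily lam W t) ξ -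
        h • blochDensity a K (fun σ x => lam σ * evolvedFamily lam W t σ x) ξ‖ ≤
      L ^ 2 * h ^ 2 * ‖blochDensity a K (evolvedFamily lam W t) ξ‖ := by
  unfold evolvedFamily
  simp only [blochDensity_mul a K (fun σ => (Real.exp (lam σ * _) : ℂ)),
    blochDensity_mul a K (fun σ => (lam σ : ℂ))]
  by_cases hξ : (blochCoord a ((2 * Real.pi) • ξ)).2 ∈ K
  · set l := lam (blochCoord a ((2 * Real.pi) • ξ)).2
    have hfactor (d : ℂ) : (Real.exp (l * (t + h)) : ℂ) * d - (Real.exp (l * t) : ℂ) * d -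
        h • ((l : ℂ) * ((Real.exp (l * t) : ℂ) * d)) =
        ((Real.exp (l * (t + h)) - Real.exp (l * t) - h * (l * Real.exp (l * t)) : ℝ) : ℂ) * d := by
      rw [Complex.real_smul]
      push_cast
      ring
    rw [hfactor, norm_mul, norm_mul, Complex.norm_real, Complex.norm_real, Real.norm_eq_abs,
      Real.norm_of_nonneg (Real.exp_pos _).le, ← mul_assoc (L ^ 2 * h ^ 2)]
    gcongr
    exact abs_exp_mul_add_sub_le (hL _ hξ) hh
  · simp [blochDensity_eq_zero hξ]

theorem IsBlochFamilyOn.hasDerivAt_toLp_evolvedFamily (hW : IsBlochFamilyOn K W)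
    (hK : IsCompact K) (hKa : K ⊆ strip a) (hl : ContinuousOn lam K)
    (hU : ∀ t, MemLp (blochSuperposition K (evolvedFamily lam W t)) 2 volume) {t : ℝ}
    (hlU : MemLp (blochSuperposition K fun σ x => lam σ * evolvedFamily lam W t σ x) 2 volume) :
    HasDerivAt (fun r => ((hU r).toLp : L2Plane)) hlU.toLp t := by
  obtain ⟨L, hL⟩ := hK.exists_bound_of_continuousOn hl
  have hWt (r : ℝ) := hW.exp_mul hK hl r
  have hlWt := (hWt t).eigenvalue_mul hK hl
  have hsmall : ∀ᶠ h : ℝ in 𝓝 0, L * |h| ≤ 1 :=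
    ((by fun_prop : Continuous fun h : ℝ => L * |h|).tendsto' 0 0 (by simp)).eventually_le_const
      one_pos
  have hdensity := hasDerivAt_toLp_of_norm_le (fun r => (hWt r).memLp_two_blochDensity hK a)
    (hlWt.memLp_two_blochDensity hK a)
    (hsmall.mono fun h hh => norm_blochDensity_evolvedFamily_sub_le (t := t) hL hh)
  have hsymm {F : ℝ × ℝ → ℝ → ℂ} (hF : IsBlochFamilyOn K F)
      (hFU : MemLp (blochSuperposition K F) 2 volume) :
      (hFU.toLp : L2Plane) = 𝓕⁻ ((hF.memLp_two_blochDensity hK a).toLp : L2Plane) := by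
    rw [← hF.fourier_toLp_blochSuperposition hK hKa hFU, FourierTransform.fourierInv_fourier_eq]
  simp only [fun r => hsymm (hWt r) (hU r), hsymm hlWt hlU]
  exact (((Lp.fourierTransformₗᵢ Plane ℂ).symm.toContinuousLinearEquiv.toContinuousLinearMap
    ).restrictScalars ℝ).hasFDerivAt.comp_hasDerivAt t hdensity

theorem IsBlochFamilyOn.exists_linearizedOp_evolvedFamily {ε ω b s : ℝ}
    (hW : IsBlochFamilyOn K W) (hk : 0 < 1 + 2 * ε * ω) {u : ℝ → ℝ} (hu : Continuous u)
    (hup : Function.Periodic u (2 * Real.pi))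
    (hE : ∀ σ ∈ K, IsBlochEigenfunction ε ω b s u σ (lam σ) (W σ))
    (hK : IsCompact K) (hKa : K ⊆ strip a) (hl : ContinuousOn lam K)
    (hU : ∀ t, MemLp (blochSuperposition K (evolvedFamily lam W t)) 2 volume) (t : ℝ) :
    ∃ f, LinearizedOp ε ω b s u (hU t).toLp f ∧
      HasDerivAt (fun r => ((hU r).toLp : L2Plane)) f t := by
  have hWt := hW.exp_mul hK hl t
  have hlWt := hWt.eigenvalue_mul hK hl
  have hlU := hlWt.memLp_two_blochSuperposition hK hKa
  have hEt : ∀ σ ∈ K, IsBlochEigenfunction ε ω b s u σ (lam σ) (evolvedFamily lam W t σ) :=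
    fun σ hσ => (hE σ hσ).const_mul (Complex.ofReal_ne_zero.2 (Real.exp_ne_zero _))
  exact ⟨_, linearizedOp_blochSuperposition hk hu hup hEt hK hWt hlWt (hU t) hlU,
    hW.hasDerivAt_toLp_evolvedFamily hK hKa hl hU hlU⟩

theorem isSemigroupOrbit_of_forall_hasDerivAt {L : L2Plane → L2Plane → Prop} {V : ℝ → L2Plane}
    (hV : ∀ t, ∃ f, L (V t) f ∧ HasDerivAt V f t) : IsSemigroupOrbit L (V 0) V := by
  refine ⟨rfl, fun t _ => ?_, fun t _ => hV t⟩
  obtain ⟨f, -, hf⟩ := hV t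
  exact hf.continuousAt.continuousWithinAt

end Evolution

/-! ### Sobolev norms of superpositions -/

/-- The squared `H^p` norm over a period of the Bloch wave `e^{i(σ₁x + σ₂y)} w(x)`, whose
frequencies are `(σ₁ + j, σ₂)`, `j ∈ ℤ`. -/
def blochSobolevSq (p : ℕ) (σ : ℝ × ℝ) (w : ℝ → ℂ) : ℝ≥0∞ :=
  ∑' j : ℤ, ENNReal.ofReal ((1 + (σ.1 + j) ^ 2 + σ.2 ^ 2) ^ p * ‖torusCoeff w j‖ ^ 2)

theorem one_add_sq_le_mul_one_add_sq {R x y z : ℝ} (hx : |x| ≤ R) (hz : |z| ≤ R) :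
    1 + y ^ 2 ≤ (2 + 3 * R ^ 2) * (1 + (x + y) ^ 2 + z ^ 2) ∧
      1 + (x + y) ^ 2 + z ^ 2 ≤ (2 + 3 * R ^ 2) * (1 + y ^ 2) := by
  have hx₂ : x ^ 2 ≤ R ^ 2 := sq_le_sq' (abs_le.1 hx).1 (abs_le.1 hx).2
  have hz₂ : z ^ 2 ≤ R ^ 2 := sq_le_sq' (abs_le.1 hz).1 (abs_le.1 hz).2
  have hy₀ : 0 ≤ R ^ 2 * y ^ 2 := by positivity
  have hxy₀ : 0 ≤ R ^ 2 * (x + y) ^ 2 := by positivity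
  have hz₀ : 0 ≤ R ^ 2 * z ^ 2 := by positivity
  constructor
  · nlinarith [sq_nonneg (2 * x + y), sq_nonneg z]
  · nlinarith [sq_nonneg (x - y)]

theorem tsum_ofReal_pow_mul_le {c : ℝ} (hc : 0 ≤ c) {v w : ℤ → ℝ} (hv : ∀ j, 0 ≤ v j)
    (hvw : ∀ j, v j ≤ c * w j) (p : ℕ) {r : ℤ → ℝ} (hr : ∀ j, 0 ≤ r j) :
    ∑' j, ENNReal.ofReal (v j ^ p * r j) ≤
      ENNReal.ofReal (c ^ p) * ∑' j, ENNReal.ofReal (w j ^ p * r j) := by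
  rw [← ENNReal.tsum_mul_left]
  refine ENNReal.tsum_le_tsum fun j => ?_
  rw [← ENNReal.ofReal_mul (by positivity), ← mul_assoc, ← mul_pow]
  exact ENNReal.ofReal_le_ofReal
    (mul_le_mul_of_nonneg_right (pow_le_pow_left₀ (hv j) (hvw j) p) (hr j))

theorem exists_blochSobolevSq_comparison {K : Set (ℝ × ℝ)} (hK : IsCompact K) (p : ℕ) :
    ∃ c : NNReal, 0 < c ∧ ∀ σ ∈ K, ∀ w : ℝ → ℂ, torusSobolevSq p w ≤ c * blochSobolevSq p σ w ∧
      blochSobolevSq p σ w ≤ c * torusSobolevSq p w := by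
  obtain ⟨R, hR⟩ := hK.exists_bound_of_continuousOn (f := id) continuousOn_id
  refine ⟨((2 + 3 * R ^ 2) ^ p).toNNReal, Real.toNNReal_pos.2 (by positivity), fun σ hσ w => ?_⟩
  have hweight (j : ℤ) := one_add_sq_le_mul_one_add_sq (y := j)
    ((norm_fst_le σ).trans (hR σ hσ)) ((norm_snd_le σ).trans (hR σ hσ))
  exact ⟨tsum_ofReal_pow_mul_le (by positivity) (fun j => by positivity) (fun j => (hweight j).1) p
      fun j => by positivity,
    tsum_ofReal_pow_mul_le (by positivity) (fun j => by positivity) (fun j => (hweight j).2) p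
      fun j => by positivity⟩

theorem norm_sq_eq_blochCoord (a : ℝ) (ξ : Plane) :
    ‖ξ‖ ^ 2 = ((blochCoord a ξ).2.1 + (blochCoord a ξ).1) ^ 2 + (blochCoord a ξ).2.2 ^ 2 := by
  rw [plane_norm_sq, blochCoord, add_comm (foldReal a (ξ 0)).2, foldReal_add]

theorem sobolevNorm_sq (p : ℕ) (v : L2Plane) :
    sobolevNorm p v ^ 2 = (∫⁻ ξ : Plane,
      ENNReal.ofReal ((1 + ‖(2 * Real.pi) • ξ‖ ^ 2) ^ p * ‖(𝓕 v : L2Plane) ξ‖ ^ 2)).toReal := by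
  have hsq := eLpNorm_nnreal_pow_eq_lintegral (μ := (volume : Measure Plane)) (p := 2)
    (f := fun ξ : Plane => (((1 + (2 * Real.pi * ‖ξ‖) ^ 2) ^ ((p : ℝ) / 2) : ℝ) : ℂ) *
      (𝓕 v : L2Plane) ξ) two_ne_zero
  simp only [NNReal.coe_ofNat, ENNReal.coe_ofNat, ENNReal.rpow_ofNat] at hsq
  rw [sobolevNorm, ← ENNReal.toReal_pow, hsq]
  congr 1
  refine lintegral_congr fun ξ => ?_
  rw [← ofReal_norm, ← ENNReal.ofReal_pow (norm_nonneg _), norm_mul, Complex.norm_real,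
    Real.norm_of_nonneg (by positivity), mul_pow, ← Real.rpow_mul_natCast (by positivity),
    Nat.cast_ofNat, div_mul_cancel₀ _ two_ne_zero, Real.rpow_natCast, norm_smul,
    Real.norm_of_nonneg Real.two_pi_pos.le]

section SobolevNorm

variable {a : ℝ} {K : Set (ℝ × ℝ)} {W : ℝ × ℝ → ℝ → ℂ}

theorem IsBlochFamilyOn.sobolevNorm_toLp_sq (hW : IsBlochFamilyOn K W) (hK : IsCompact K)
    (hKa : K ⊆ strip a) (hU : MemLp (blochSuperposition K W) 2 volume) (p : ℕ) :
    sobolevNorm p hU.toLp ^ 2 =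
      (2 * Real.pi) ^ 2 * (∫⁻ σ in K, blochSobolevSq p σ (W σ)).toReal := by
  set F : ℤ × (ℝ × ℝ) → ℝ≥0∞ := fun z => ENNReal.ofReal
    ((1 + ((z.2.1 + z.1) ^ 2 + z.2.2 ^ 2)) ^ p * ‖((2 * Real.pi) ^ 2 : ℝ) • blochCoeff K W z‖ ^ 2)
    with hF
  have hFmeas : Measurable F := by
    have hint : Measurable fun z : ℤ × (ℝ × ℝ) => (z.1 : ℝ) :=
      (measurable_from_top (f := Int.cast)).comp measurable_fst
    have hcoeff := hW.measurable_blochCoeff hK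
    fun_prop
  have hsum (σ : ℝ × ℝ) : ∑' j : ℤ, F (j, σ) = ENNReal.ofReal (((2 * Real.pi) ^ 2) ^ 2) *
      K.indicator (fun σ => blochSobolevSq p σ (W σ)) σ := by
    by_cases hσ : σ ∈ K
    · simp only [hF, blochCoeff, Set.indicator_of_mem hσ, blochSobolevSq,
        ← ENNReal.tsum_mul_left, norm_smul, mul_pow]
      refine tsum_congr fun j => ?_
      rw [← ENNReal.ofReal_mul (by positivity), Real.norm_of_nonneg (by positivity)]
      ring_nf
    · simp [hF, blochCoeff, hσ]
  have hdensity : ∫⁻ ξ : Plane, ENNReal.ofReal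
      ((1 + ‖(2 * Real.pi) • ξ‖ ^ 2) ^ p * ‖(𝓕 (hU.toLp : L2Plane) : L2Plane) ξ‖ ^ 2) =
      ∫⁻ ξ : Plane, F (blochCoord a ((2 * Real.pi) • ξ)) := by
    rw [hW.fourier_toLp_blochSuperposition hK hKa hU]
    refine lintegral_congr_ae ?_
    filter_upwards [(hW.memLp_two_blochDensity hK a).coeFn_toLp] with ξ hξ
    rw [hξ, norm_sq_eq_blochCoord a, blochDensity]
  rw [sobolevNorm_sq, hdensity, lintegral_blochCoord_smul a hFmeas]
  simp only [hsum]
  rw [lintegral_const_mul' _ _ ENNReal.ofReal_ne_top, lintegral_indicator hK.measurableSet,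
    Measure.restrict_restrict hK.measurableSet, Set.inter_eq_left.2 hKa, ENNReal.toReal_mul,
    ENNReal.toReal_mul, ENNReal.toReal_ofReal (by positivity),
    ENNReal.toReal_ofReal (by positivity)]
  field_simp

theorem exists_blochSobolevSq_evolvedFamily_bounds (hK : IsCompact K) (lam : ℝ × ℝ → ℝ) {p : ℕ}
    {A B : NNReal} (hA₀ : 0 < A) (hA : ∀ σ ∈ K, A ≤ torusSobolevSq p (W σ))
    (hB : ∀ σ ∈ K, torusSobolevSq p (W σ) ≤ B) :
    ∃ m₁ m₂ : NNReal, 0 < m₁ ∧ ∀ t, ∀ σ ∈ K,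
      m₁ * ENNReal.ofReal (Real.exp (2 * lam σ * t)) ≤
        blochSobolevSq p σ (evolvedFamily lam W t σ) ∧
      blochSobolevSq p σ (evolvedFamily lam W t σ) ≤
        m₂ * ENNReal.ofReal (Real.exp (2 * lam σ * t)) := by
  obtain ⟨c, hc, hcmp⟩ := exists_blochSobolevSq_comparison hK p
  refine ⟨c⁻¹ * A, c * B, by positivity, fun t σ hσ => ?_⟩
  have hscale : torusSobolevSq p (evolvedFamily lam W t σ) =
      ENNReal.ofReal (Real.exp (2 * lam σ * t)) * torusSobolevSq p (W σ) := by
    unfold evolvedFamily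
    rw [torusSobolevSq_const_mul, Complex.norm_real, Real.norm_of_nonneg (Real.exp_pos _).le,
      ← Real.exp_nat_mul]
    push_cast
    ring_nf
  obtain ⟨hle, hge⟩ := hcmp σ hσ (evolvedFamily lam W t σ)
  rw [hscale] at hle hge
  constructor
  · rw [ENNReal.coe_mul, ENNReal.coe_inv hc.ne', mul_assoc, ENNReal.inv_mul_le_iff
      (by exact_mod_cast hc.ne') ENNReal.coe_ne_top, mul_comm]
    exact (mul_le_mul_right (hA σ hσ) _).trans hle
  · rw [ENNReal.coe_mul, mul_assoc, mul_comm (B : ℝ≥0∞)]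
    exact hge.trans (mul_le_mul_right (mul_le_mul_right (hB σ hσ) _) _)

theorem toReal_lintegral_bounds {α : Type*} [MeasurableSpace α] {μ : Measure α} {f : α → ℝ≥0∞}
    {g : α → ℝ} (hg : Integrable g μ) (hg₀ : 0 ≤ᵐ[μ] g) {m₁ m₂ : NNReal}
    (h₁ : ∀ᵐ x ∂μ, m₁ * ENNReal.ofReal (g x) ≤ f x)
    (h₂ : ∀ᵐ x ∂μ, f x ≤ m₂ * ENNReal.ofReal (g x)) :
    m₁ * ∫ x, g x ∂μ ≤ (∫⁻ x, f x ∂μ).toReal ∧ (∫⁻ x, f x ∂μ).toReal ≤ m₂ * ∫ x, g x ∂μ := by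
  have hmul (m : NNReal) :
      ∫⁻ x, m * ENNReal.ofReal (g x) ∂μ = ENNReal.ofReal (m * ∫ x, g x ∂μ) := by
    rw [lintegral_const_mul' _ _ ENNReal.coe_ne_top, ← ofReal_integral_eq_lintegral_ofReal hg hg₀,
      ENNReal.ofReal_mul m.coe_nonneg, ENNReal.ofReal_coe_nnreal]
  have hlower := (hmul m₁).symm.trans_le (lintegral_mono_ae h₁)
  have hupper := (lintegral_mono_ae h₂).trans_eq (hmul m₂)
  have hne := ne_top_of_le_ne_top ENNReal.ofReal_ne_top hupper
  exact ⟨(ENNReal.ofReal_le_iff_le_toReal hne).1 hlower,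
    ENNReal.toReal_le_of_le_ofReal (mul_nonneg m₂.coe_nonneg (integral_nonneg_of_ae hg₀)) hupper⟩

theorem IsBlochFamilyOn.exists_sobolevNorm_sq_bounds (hW : IsBlochFamilyOn K W) (hK : IsCompact K)
    (hKa : K ⊆ strip a) {lam : ℝ × ℝ → ℝ} (hl : ContinuousOn lam K) {p : ℕ} {A B : NNReal}
    (hA₀ : 0 < A) (hA : ∀ σ ∈ K, A ≤ torusSobolevSq p (W σ))
    (hB : ∀ σ ∈ K, torusSobolevSq p (W σ) ≤ B)
    (hU : ∀ t, MemLp (blochSuperposition K (evolvedFamily lam W t)) 2 volume) :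
    ∃ m₁ m₂ : ℝ, 0 < m₁ ∧ ∀ t,
      m₁ * ∫ σ in K, Real.exp (2 * lam σ * t) ≤ sobolevNorm p (hU t).toLp ^ 2 ∧
      sobolevNorm p (hU t).toLp ^ 2 ≤ m₂ * ∫ σ in K, Real.exp (2 * lam σ * t) := by
  obtain ⟨m₁, m₂, hm₁, hm⟩ := exists_blochSobolevSq_evolvedFamily_bounds hK lam hA₀ hA hB
  refine ⟨(2 * Real.pi) ^ 2 * m₁, (2 * Real.pi) ^ 2 * m₂, by positivity, fun t => ?_⟩
  have hint : IntegrableOn (fun σ => Real.exp (2 * lam σ * t)) K :=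
    ContinuousOn.integrableOn_compact hK (by fun_prop)
  obtain ⟨hlower, hupper⟩ := toReal_lintegral_bounds hint (.of_forall fun _ => (Real.exp_pos _).le)
    (ae_restrict_of_forall_mem hK.measurableSet fun σ hσ => (hm t σ hσ).1)
    (ae_restrict_of_forall_mem hK.measurableSet fun σ hσ => (hm t σ hσ).2)
  rw [(hW.exp_mul hK hl t).sobolevNorm_toLp_sq hK hKa (hU t), mul_assoc, mul_assoc]
  constructor <;> gcongr

end SobolevNorm

theorem exp_mul_prefactor_sq (lam : ℝ × ℝ → ℝ) (σbar : ℝ × ℝ) (c t : ℝ) :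
    (Real.exp (lam σbar * t) * prefactor lam σbar c t) ^ 2 =
      ∫ σ in square σbar c, Real.exp (2 * lam σ * t) := by
  rw [mul_pow, prefactor, Real.sq_sqrt (integral_nonneg fun _ => (Real.exp_pos _).le),
    ← integral_const_mul, ← Real.exp_nat_mul]
  simp only [← Real.exp_add]
  refine integral_congr_ae (.of_forall fun σ => congrArg Real.exp ?_)
  push_cast
  ring

theorem inv_mul_le_and_le_mul_of_sq {x y m₁ m₂ C : ℝ} (hx : 0 ≤ x) (hy : 0 ≤ y) (hm₁ : 0 < m₁)
    (hC : 1 ≤ C) (hC₁ : m₁⁻¹ ≤ C) (hC₂ : m₂ ≤ C) (hlower : m₁ * x ^ 2 ≤ y ^ 2)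
    (hupper : y ^ 2 ≤ m₂ * x ^ 2) : C⁻¹ * x ≤ y ∧ y ≤ C * x := by
  have hC₀ : 0 < C := one_pos.trans_le hC
  have hCC : C ≤ C ^ 2 := le_self_pow₀ hC two_ne_zero
  constructor
  · rw [inv_mul_le_iff₀ hC₀]
    refine (pow_le_pow_iff_left₀ (by positivity) (by positivity) two_ne_zero).1 ?_
    calc x ^ 2 ≤ m₁⁻¹ * y ^ 2 := (le_inv_mul_iff₀ hm₁).2 hlower
      _ ≤ C ^ 2 * y ^ 2 := by gcongr; exact hC₁.trans hCC
      _ = (C * y) ^ 2 := (mul_pow ..).symm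
  · refine (pow_le_pow_iff_left₀ (by positivity) (by positivity) two_ne_zero).1 ?_
    calc y ^ 2 ≤ m₂ * x ^ 2 := hupper
      _ ≤ C ^ 2 * x ^ 2 := by gcongr; exact hC₂.trans hCC
      _ = (C * x) ^ 2 := (mul_pow ..).symm

/-! ### Bounds for eigenfunction families -/

section Eigenfunctions

variable {ε ω b s : ℝ} {u : ℝ → ℝ} {K : Set (ℝ × ℝ)} {lam : ℝ × ℝ → ℝ} {W : ℝ × ℝ → ℝ → ℂ}

theorem IsBlochEigenfunction.torusSobolevSq_two_ne_top {μ : ℝ} {σ : ℝ × ℝ} {w : ℝ → ℂ}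
    (hw : IsBlochEigenfunction ε ω b s u σ μ w) : torusSobolevSq 2 w ≠ ∞ :=
  torusSobolevSq_ne_top_of_contDiff (n := 2) (by norm_num) hw.1 hw.2.1

theorem ContinuousFamilyOn.isBlochFamilyOn_of_eigenfunction (hcont : ContinuousFamilyOn 2 W K)
    (hK : IsCompact K) (hE : ∀ σ ∈ K, IsBlochEigenfunction ε ω b s u σ (lam σ) (W σ)) :
    IsBlochFamilyOn K W :=
  hcont.isBlochFamilyOn hK (fun σ hσ => (hE σ hσ).1.continuous) (fun σ hσ => (hE σ hσ).2.1)
    fun σ hσ => (hE σ hσ).torusSobolevSq_two_ne_top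

theorem ContinuousFamilyOn.exists_sobolevNorm_bounds {σbar : ℝ × ℝ} {c : ℝ} (hc : c ≤ 1)
    (hcont : ContinuousFamilyOn 2 W (square σbar c))
    (hE : ∀ σ ∈ square σbar c, IsBlochEigenfunction ε ω b s u σ (lam σ) (W σ))
    (hl : ContinuousOn lam (square σbar c))
    (hU : ∀ t, MemLp (blochSuperposition (square σbar c) (evolvedFamily lam W t)) 2 volume) :
    ∃ C : ℝ, 1 ≤ C ∧ ∀ t,
      C⁻¹ * (Real.exp (lam σbar * t) * prefactor lam σbar c t) ≤ sobolevNorm 2 (hU t).toLp ∧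
      sobolevNorm 2 (hU t).toLp ≤ C * (Real.exp (lam σbar * t) * prefactor lam σbar c t) := by
  have hK := isCompact_square σbar c
  have hWc : ∀ σ ∈ square σbar c, Continuous (W σ) := fun σ hσ => (hE σ hσ).1.continuous
  obtain ⟨A, hA₀, hA⟩ := hcont.exists_le_torusSobolevSq hK hWc (fun σ hσ => (hE σ hσ).2.1)
    fun σ hσ => (hE σ hσ).2.2.1
  obtain ⟨B, hB⟩ := hcont.exists_torusSobolevSq_le hK hWc
    fun σ hσ => (hE σ hσ).torusSobolevSq_two_ne_top
  obtain ⟨m₁, m₂, hm₁, hm⟩ := (hcont.isBlochFamilyOn_of_eigenfunction hK hE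
    ).exists_sobolevNorm_sq_bounds hK (square_subset_strip σbar hc) hl hA₀ hA hB hU
  refine ⟨max 1 (max m₁⁻¹ m₂), le_max_left _ _, fun t => ?_⟩
  simp only [← exp_mul_prefactor_sq] at hm
  exact inv_mul_le_and_le_mul_of_sq (mul_nonneg (Real.exp_pos _).le (Real.sqrt_nonneg _))
    ENNReal.toReal_nonneg hm₁ (le_max_left _ _) (le_max_of_le_right (le_max_left _ _))
    (le_max_of_le_right (le_max_right _ _)) (hm t).1 (hm t).2

end Eigenfunctions

end RollInstability

end

open RollInstability in
theorem proposition2p3_general {ε ω b s : ℝ} (hk : 0 < 1 + 2 * ε * ω) {u : ℝ → ℝ}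
    (hu : Continuous u) (hup : Function.Periodic u (2 * Real.pi)) {σbar : ℝ × ℝ} {c₀ : ℝ}
    (hc₀ : 0 < c₀) (hc₁ : c₀ ≤ 1) {lam : ℝ × ℝ → ℝ} {W : ℝ × ℝ → ℝ → ℂ}
    (hle : ∀ σ ∈ square σbar c₀, lam σ ≤ lam σbar)
    (hW : ∀ σ ∈ square σbar c₀, IsBlochEigenfunction ε ω b s u σ (lam σ) (W σ))
    (hcont : ContinuousFamilyOn 2 W (square σbar c₀)) :
    (∃ hU : MemLp (blochSuperposition (square σbar c₀) W) 2 (volume : Measure Plane),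
      ∃ V : ℝ → L2Plane,
        IsSemigroupOrbit (LinearizedOp ε ω b s u) hU.toLp V ∧
        (∀ V' : ℝ → L2Plane, IsSemigroupOrbit (LinearizedOp ε ω b s u) hU.toLp V' →
          ∀ t, 0 ≤ t → V' t = V t) ∧
        (∀ t, 0 ≤ t → MemSobolev 2 2 (V t : 𝓢'(Plane, ℂ))) ∧
        ∃ C : ℝ, 1 ≤ C ∧ ∀ t, 0 ≤ t →
          C⁻¹ * (Real.exp (lam σbar * t) * prefactor lam σbar c₀ t) ≤ sobolevNorm 2 (V t) ∧
          sobolevNorm 2 (V t) ≤ C * (Real.exp (lam σbar * t) * prefactor lam σbar c₀ t)) ∧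
    (∃ l C₁ C₂ : ℝ, 0 < l ∧ 0 < C₁ ∧ 0 < C₂ ∧ ∀ t, 0 ≤ t →
      C₁ / (1 + t) ^ (1 / l) ≤ prefactor lam σbar c₀ t ∧ prefactor lam σbar c₀ t ≤ C₂) ∧
    (∀ l : ℕ, 0 < l →
      (fun σ => lam σ - lam σbar) =O[𝓝[square σbar c₀] σbar] (fun σ => ‖σ - σbar‖ ^ l) →
      ∃ C₁ : ℝ, 0 < C₁ ∧ ∀ t, 0 ≤ t →
        C₁ / (1 + t) ^ (1 / (l : ℝ)) ≤ prefactor lam σbar c₀ t) := by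
  have hK := isCompact_square σbar c₀
  have hKa := square_subset_strip σbar hc₁
  have hWK := hcont.isBlochFamilyOn_of_eigenfunction hK hW
  have hl := continuousOn_eigenvalue hu hW hWK
  refine ⟨?_, ?_, fun l hl₀ hO => exists_prefactor_ge hc₀ hl hl₀.ne' hO⟩
  · obtain ⟨M, hM⟩ := exists_abs_potential_le hu hup ε b s
    have hU (t : ℝ) := (hWK.exp_mul hK hl t).memLp_two_blochSuperposition hK hKa
    have hV := hWK.exists_linearizedOp_evolvedFamily hk hu hup hW hK hKa hl hU
    have horbit := isSemigroupOrbit_of_forall_hasDerivAt hV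
    obtain ⟨C, hC, hbounds⟩ := hcont.exists_sobolevNorm_bounds hc₁ hW hl hU
    rw [← evolvedFamily_zero lam W]
    exact ⟨hU 0, fun t => (hU t).toLp, horbit, fun _ hV' _ => horbit.eq_of_linearizedOp hM hV',
      fun t _ => (hV t).elim fun _ h => h.1.1.mono (by norm_num), C, hC, fun t _ => hbounds t⟩
  · have hlip := (eigenvalue_sub_isBigO hu hW hWK (mem_square_self σbar hc₀.le)).norm_right
    obtain ⟨C₁, hC₁, hge⟩ := exists_prefactor_ge hc₀ hl one_ne_zero (by simpa using hlip)
    exact ⟨1, C₁, c₀, one_pos, hC₁, hc₀, fun t ht =>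
      ⟨by simpa using hge t ht, prefactor_le hc₀.le hl hle ht⟩⟩

open RollInstability in
theorem proposition2p3
    (ε ω b s : ℝ) (hb : b ≠ 0) (hs : 0 < 27 * s - 38 * b ^ 2)
    (hε : 0 < ε) (hω : ω ∈ Set.Ioo (-1 / 2 : ℝ) (1 / 2)) (hk : 0 < 1 + 2 * ε * ω)
    (u : ℝ → ℝ) (hu : IsRoll ε ω b s u)
    (σbar : ℝ × ℝ) (c₀ : ℝ) (hc₀ : 0 < c₀) (hc₁ : c₀ ≤ 1)
    (lam : ℝ × ℝ → ℝ) (W : ℝ × ℝ → ℝ → ℂ)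
    (hmax : ∀ (σ : ℝ × ℝ) (μ : ℝ), (∃ w, IsBlochEigenfunction ε ω b s u σ μ w) → μ ≤ lam σbar)
    (hpos : ∀ σ ∈ square σbar c₀, 0 < lam σ)
    (hW : ∀ σ ∈ square σbar c₀, IsBlochEigenfunction ε ω b s u σ (lam σ) (W σ))
    (hcont : ContinuousFamilyOn 2 W (square σbar c₀)) :
    (∃ hU : MemLp (blochSuperposition (square σbar c₀) W) 2 (volume : Measure Plane),
      ∃ V : ℝ → L2Plane,
        IsSemigroupOrbit (LinearizedOp ε ω b s u) hU.toLp V ∧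
        (∀ V' : ℝ → L2Plane, IsSemigroupOrbit (LinearizedOp ε ω b s u) hU.toLp V' →
          ∀ t, 0 ≤ t → V' t = V t) ∧
        (∀ t, 0 ≤ t → MemSobolev 2 2 (V t : 𝓢'(Plane, ℂ))) ∧
        ∃ C : ℝ, 1 ≤ C ∧ ∀ t, 0 ≤ t →
          C⁻¹ * (Real.exp (lam σbar * t) * prefactor lam σbar c₀ t) ≤ sobolevNorm 2 (V t) ∧
          sobolevNorm 2 (V t) ≤ C * (Real.exp (lam σbar * t) * prefactor lam σbar c₀ t)) ∧
    (∃ l C₁ C₂ : ℝ, 0 < l ∧ 0 < C₁ ∧ 0 < C₂ ∧ ∀ t, 0 ≤ t →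
      C₁ / (1 + t) ^ (1 / l) ≤ prefactor lam σbar c₀ t ∧ prefactor lam σbar c₀ t ≤ C₂) ∧
    (∀ l : ℕ, 0 < l →
      (fun σ => lam σ - lam σbar) =O[𝓝[square σbar c₀] σbar] (fun σ => ‖σ - σbar‖ ^ l) →
      ∃ C₁ : ℝ, 0 < C₁ ∧ ∀ t, 0 ≤ t →
        C₁ / (1 + t) ^ (1 / (l : ℝ)) ≤ prefactor lam σbar c₀ t) :=
  proposition2p3_general hk hu.1.continuous hu.2.1 hc₀ hc₁
    (fun σ hσ => hmax σ _ ⟨_, hW σ hσ⟩) hW hcont
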